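/- Let $K\subset S^3$ be a figure eight knot, let $x\in S^3\setminus K$, and let $\omega=e^{-i\pi/3}$, so that $\mathbb Z[\omega]$ is the ring of Eisenstein integers. Let $\mathrm{U}(2,1)\subset \mathrm{GL}(3,\mathbb C)$ be the unitary group of the Hermitian form $\langle z,w\rangle=z_1\overline w_3+z_2\overline w_2+z_3\overline w_1$ on $\mathbb C^3$, let $\mathrm{PU}(2,1)$ be its quotient by its centre, with the quotient topology, let $\mathrm{SU}(2,1,\mathbb Z[\omega])$ be the set of elements of $\mathrm{U}(2,1)$ with determinant $1$ and entries in $\mathbb Z[\omega]$, and let $\mathrm{PU}(2,1,\mathbb Z[\omega])$ be its image in $\mathrm{PU}(2,1)$. Put $$ G_1=\begin{pmatrix}1&\omega&-\omega\\0&1&-\overline\omega\\0&0&1\end{pmatrix},\quad G_2=\begin{pmatrix}1&1&-\omega\\-1&0&-\overline\omega\\-\overline\omega&\omega&1\end{pmatrix},\quad G_3=\begin{pmatrix}1&1&-\omega\\-\omega&\overline\omega&-1-\overline\omega\\-\overline\omega&0&1+\omega\end{pmatrix}. $$ Then $G_1,G_2,G_3\in \mathrm{SU}(2,1,\mathbb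 Z[\omega])$, and the fundamental group $\pi_1(S^3\setminus K,x)$ is generated by three elements $g_1,g_2,g_3$ satisfying the edge relations $$ g_1g_2=g_2g_3,\qquad g_2g_1^{-1}g_3g_1=g_3 $$ of the decomposition of the complement into two ideal tetrahedra, for which there is a homomorphism $$ \rho:\pi_1(S^3\setminus K,x)\longrightarrow \mathrm{PU}(2,1) $$ such that $\rho(g_i)$ is the class of $G_i$ for $i=1,2,3$. The image of $\rho$ is contained in $\mathrm{PU}(2,1,\mathbb Z[\omega])$ and is a discrete subgroup of $\mathrm{PU}(2,1)$. -/

import Mathlib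

open scoped Matrix

namespace FigureEight

/-! ### The figure eight knot -/

/-- Euclidean three-space. -/
abbrev E3 : Type := EuclideanSpace ℝ (Fin 3)

/-- The three-sphere, as the unit sphere of `ℝ⁴`. -/
abbrev S3 : Type := Metric.sphere (0 : EuclideanSpace ℝ (Fin 4)) 1

/-- The vertices, in cyclic order, of a polygonal figure eight knot in `ℝ³`.

Over the grid `{0,…,5}²` the knot runs alternately along a segment in the `y`-direction at height
`z = 1` and along a segment in the `x`-direction at height `z = 0`; these are joined by
vertical segments of length one.  Projecting to the `(x, y)`-plane gives a diagram with exactly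
four crossings, at `(1,4)`, `(2,2)`, `(3,3)`, `(4,1)`, where the `y`-segment passes over
the `x`-segment.  From the first vertex on one meets the crossings in the order
`(1,4)` under, `(3,3)` over, `(2,2)` under, `(1,4)` over, `(4,1)` under, `(2,2)` over,
`(3,3)` under, `(4,1)` over: this is the reduced alternating diagram with four crossings. -/
noncomputable def vertex : Fin 24 → E3 :=
  ![!₂[0, 0, 1], !₂[0, 4, 1], !₂[0, 4, 0], !₂[3, 4, 0],
    !₂[3, 4, 1], !₂[3, 2, 1], !₂[3, 2, 0], !₂[1, 2, 0],
    !₂[1, 2, 1], !₂[1, 5, 1], !₂[1, 5, 0], !₂[5, 5, 0],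
    !₂[5, 5, 1], !₂[5, 1, 1], !₂[5, 1, 0], !₂[2, 1, 0],
    !₂[2, 1, 1], !₂[2, 3, 1], !₂[2, 3, 0], !₂[4, 3, 0],
    !₂[4, 3, 1], !₂[4, 0, 1], !₂[4, 0, 0], !₂[0, 0, 0]]

/-- The closed polygon through the points `vertex i` (the index `i + 1` is taken modulo `24`). -/
noncomputable def polygon : Set E3 := ⋃ i : Fin 24, segment ℝ (vertex i) (vertex (i + 1))

/-- A subset of the three-sphere is a figure eight knot if some homeomorphism
`ℝ³ ∪ {∞} ≃ S³` carries the polygonal figure eight knot onto it.  (The figure eight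
knot is isotopic to its mirror image, so orientations play no role.) -/
def IsFigureEightKnot (K : Set S3) : Prop :=
  ∃ h : OnePoint E3 ≃ₜ S3, K = h '' ((fun p : E3 => (p : OnePoint E3)) '' polygon)

/-! ### The group `PU(2,1)` -/

/-- The Hermitian form `⟨z, w⟩ = z₁ w̄₃ + z₂ w̄₂ + z₃ w̄₁` of signature `(2,1)` on `ℂ³`. -/
noncomputable def herm (z w : Fin 3 → ℂ) : ℂ :=
  z 0 * star (w 2) + z 1 * star (w 1) + z 2 * star (w 0)

/-- The unitary group `U(2,1)` of the form `herm`, with the topology induced from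
`GL(3, ℂ)`. -/
def U21 : Subgroup (GL (Fin 3) ℂ) where
  carrier := {A | ∀ z w, herm ((A : Matrix (Fin 3) (Fin 3) ℂ) *ᵥ z)
    ((A : Matrix (Fin 3) (Fin 3) ℂ) *ᵥ w) = herm z w}
  one_mem' := by intro z w; simp
  mul_mem' := by
    intro A B hA hB z w
    rw [Units.val_mul, ← Matrix.mulVec_mulVec, ← Matrix.mulVec_mulVec, hA, hB]
  inv_mem' := by
    intro A hA z w
    rw [← hA, Matrix.mulVec_mulVec, Matrix.mulVec_mulVec, Units.mul_inv, Matrix.one_mulVec,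
      Matrix.one_mulVec]

/-- `PU(2,1)`: the quotient of `U(2,1)` by its centre (the unit scalars), with the quotient
topology. -/
abbrev PU21 : Type := U21 ⧸ Subgroup.center U21

/-- The projection `U(2,1) → PU(2,1)`. -/
def toPU : U21 →* PU21 := QuotientGroup.mk' (Subgroup.center U21)

/-- The primitive sixth root of unity `ω = e^{-iπ/3}`; `ℤ[ω]` is the ring of Eisenstein
integers. -/
noncomputable def ω : ℂ := Complex.exp (-(Complex.I * Real.pi / 3))

/-- The elements of `SU(2,1,ℤ[ω])`: unitary matrices for `herm` with determinant `1` and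
entries in `ℤ[ω]`. -/
def SU21Eisenstein : Set U21 :=
  {A | Matrix.det ((A : GL (Fin 3) ℂ) : Matrix (Fin 3) (Fin 3) ℂ) = 1 ∧
    ∀ i j, ((A : GL (Fin 3) ℂ) : Matrix (Fin 3) (Fin 3) ℂ) i j ∈ Algebra.adjoin ℤ {ω}}

/-- The three explicit matrices `G₁, G₂, G₃` (indexed by `0, 1, 2`). -/
noncomputable def G : Fin 3 → Matrix (Fin 3) (Fin 3) ℂ :=
  ![!![1, ω, -ω;
       0, 1, -star ω;
       0, 0, 1],
    !![1, 1, -ω;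
       -1, 0, -star ω;
       -star ω, ω, 1],
    !![1, 1, -ω;
       -ω, star ω, -1 - star ω;
       -star ω, 0, 1 + ω]]

end FigureEight

/-!
The proof computes the knot group by hand and then maps it to `PU(2,1)` by evaluating relations.

*The knot group.*  The polygon lies in the layer `0 ≤ z ≤ 1`, with the over-strands at height `1`
and the under-strands at height `0`.  Its complement in `ℝ³ ∪ {∞}` is covered by seven simply
connected open sets: the points that see the sky, the points that see the ground, a neighbourhood
of `∞`, and a box between the two strands at each of the four crossings.  The overlap of the first
two sets has one component for each face of the diagram, so going down through a face `r` and
coming back through the unbounded face gives a loop `faceLoop r`; the boxes give one relation at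
each crossing between the loops of the four adjacent faces.  This is the Dehn presentation, and
both halves of van Kampen's theorem are used for it, in the following form.

* Generators: cutting a path into pieces contained in the sets of the cover, one sees that the
  loops `faceLoop r` generate (`fundamentalGroup_eq_top_of_cover`, `closure_range_faceLoop`); the
  relations are `faceLoop_relation`.
* Relations: elements `g r` of a group satisfying the Dehn relations define a cocycle for the
  cover, hence a covering space, whose monodromy is a homomorphism sending `faceLoop r` to `g r`
  (`exists_holonomy`, `exists_hom_of_relations`).  The cocycle is written as the quotient of
  discontinuous functions `gauge i`, one for each set of the cover.

Eliminating generators leaves the loops `a` and `c` of two faces and a single relation, which is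
equivalent to the first edge relation for `a`, `c a⁻¹ c⁻¹ a`, `c`; the second edge relation is then
an identity in the free group (`edge_relations_of_dehn`, `dehn_of_edge_relations`).

*The representation.*  The matrices `G i` satisfy the edge relations exactly, not only up to
scalars, so they define a representation in `U(2,1)`, which is composed with the projection.
Its image lies in `PU(2,1,ℤ[ω])` because `SU(2,1,ℤ[ω])` is a group.

*Discreteness.*  The centre of `U(2,1)` consists of scalars of absolute value `1`, so the absolute
values of the off-diagonal entries and of the differences of diagonal entries are functions
on `PU(2,1)`.  If they are all less than `1` at a matrix with entries in `ℤ[ω]`, they vanish there,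
since an Eisenstein integer of absolute value less than `1` is `0`; so the matrix is a scalar and
its class is `1` (`eq_one_of_mem_nearScalar`).
-/

namespace FigureEight

open Topology unitInterval Path

/-! ### Paths and covering spaces from open covers -/

section CoverPaths

variable {X ι : Type*} [TopologicalSpace X] {U : ι → Set X}

theorem trans_symm_trans {x y z : X} (a : Homotopic.Quotient x y)
    (b : Homotopic.Quotient x z) : a.trans (a.symm.trans b) = b := by
  rw [← Homotopic.Quotient.trans_assoc, Homotopic.Quotient.trans_symm,
    Homotopic.Quotient.refl_trans]

theorem symm_trans_trans {x y z : X} (a : Homotopic.Quotient x y)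
    (b : Homotopic.Quotient y z) : a.symm.trans (a.trans b) = b := by
  rw [← Homotopic.Quotient.trans_assoc, Homotopic.Quotient.symm_trans,
    Homotopic.Quotient.refl_trans]

theorem symm_eq_of_trans_eq_refl {x y : X} {a : Homotopic.Quotient x y}
    {b : Homotopic.Quotient y x} (h : a.trans b = Homotopic.Quotient.refl x) : a.symm = b := by
  rw [← symm_trans_trans a b, h, Homotopic.Quotient.trans_refl]

theorem symm_trans_eq {x y z : X} (a : Homotopic.Quotient x y)
    (b : Homotopic.Quotient y z) : (a.trans b).symm = b.symm.trans a.symm :=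
  symm_eq_of_trans_eq_refl (by
    rw [Homotopic.Quotient.trans_assoc, trans_symm_trans, Homotopic.Quotient.trans_symm])

/-- Induction on homotopy classes of paths: a property that is stable under concatenation holds
for all classes as soon as it holds for the paths contained in one member of an open cover. -/
theorem path_induction (hU : ∀ i, IsOpen (U i)) (hcov : ∀ x, ∃ i, x ∈ U i)
    {P : ∀ {x y : X}, Homotopic.Quotient x y → Prop}
    (small : ∀ i {x y : X} (γ : Path x y), (∀ t, γ t ∈ U i) → P (Homotopic.Quotient.mk γ))
    (concat : ∀ {x y z : X} (a : Homotopic.Quotient x y) (b : Homotopic.Quotient y z),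
      P a → P b → P (a.trans b))
    {x y : X} (a : Homotopic.Quotient x y) : P a := by
  induction a using Homotopic.Quotient.ind with | _ γ
  obtain ⟨t, ht0, hmono, ⟨n, hn⟩, hsub⟩ := exists_monotone_Icc_subset_open_cover_unitInterval
    (c := fun i => γ ⁻¹' U i) (fun i => (hU i).preimage γ.continuous)
    (fun s _ => by simpa using hcov (γ s))
  have step : ∀ m, P (Homotopic.Quotient.mk (γ.subpath (t m) (t (m + 1)))) := fun m => by
    obtain ⟨i, hi⟩ := hsub m
    refine small i _ fun s => ?_
    have : γ.subpath (t m) (t (m + 1)) s ∈ Set.range (γ.subpath (t m) (t (m + 1))) := ⟨s, rfl⟩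
    rw [Path.range_subpath_of_le _ _ _ (hmono (Nat.le_succ m))] at this
    obtain ⟨r, hr, hrs⟩ := this
    rw [← hrs]
    exact hi hr
  have key : ∀ m, P (Homotopic.Quotient.mk (γ.subpath (t 0) (t (m + 1)))) := fun m => by
    induction m with
    | zero => exact step 0
    | succ k ih =>
      have h := concat _ _ ih (step (k + 1))
      rwa [← Homotopic.Quotient.mk_trans,
        Homotopic.Quotient.eq.2 ⟨Path.Homotopy.subpathTransSubpath γ _ _ _⟩] at h
  have hfin := key n
  rw [ht0, hn (n + 1) (Nat.le_succ n)] at hfin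
  rw [Path.subpath_zero_one] at hfin
  have h0 : γ 0 = x := γ.source
  have h1 : γ 1 = y := γ.target
  have : ∀ (x' y' : X) (hx : x' = x) (hy : y' = y), P (Homotopic.Quotient.mk (γ.cast hx hy)) →
      P (Homotopic.Quotient.mk γ) := by
    rintro _ _ rfl rfl h
    exact h
  exact this _ _ h0 h1 hfin

/-- The homotopy class, in the ambient space, of the paths from `b` to `p` inside a simply
connected set. -/
noncomputable def radial {V : Set X} (hV : IsSimplyConnected V) {b p : X} (hb : b ∈ V)
    (hp : p ∈ V) : Homotopic.Quotient b p :=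
  Homotopic.Quotient.mk (hV.isPathConnected.joinedIn b hb p hp).somePath

theorem mk_eq_mk_of_isSimplyConnected {V : Set X} (hV : IsSimplyConnected V) {b p : X}
    (γ γ' : Path b p) (h : ∀ t, γ t ∈ V) (h' : ∀ t, γ' t ∈ V) :
    Homotopic.Quotient.mk γ = Homotopic.Quotient.mk γ' := by
  have hb : b ∈ V := by simpa using h 0
  have hp : p ∈ V := by simpa using h 1
  have := hV.simplyConnectedSpace
  let δ : Path (⟨b, hb⟩ : V) ⟨p, hp⟩ :=
    ⟨⟨fun t => ⟨γ t, h t⟩, by fun_prop⟩, by simp, by simp⟩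
  let δ' : Path (⟨b, hb⟩ : V) ⟨p, hp⟩ :=
    ⟨⟨fun t => ⟨γ' t, h' t⟩, by fun_prop⟩, by simp, by simp⟩
  exact Homotopic.Quotient.eq.2 ((SimplyConnectedSpace.paths_homotopic δ δ').map
    ⟨Subtype.val, continuous_subtype_val⟩)

theorem mk_eq_radial {V : Set X} (hV : IsSimplyConnected V) {b p : X} (hb : b ∈ V) (hp : p ∈ V)
    (γ : Path b p) (h : ∀ t, γ t ∈ V) : Homotopic.Quotient.mk γ = radial hV hb hp :=
  mk_eq_mk_of_isSimplyConnected hV _ _ h (JoinedIn.somePath_mem _)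

theorem radial_self {V : Set X} (hV : IsSimplyConnected V) {b : X} (hb : b ∈ V) :
    radial hV hb hb = Homotopic.Quotient.refl b :=
  (mk_eq_radial hV hb hb (Path.refl b) fun _ => hb).symm

theorem radial_trans_mk {V : Set X} (hV : IsSimplyConnected V) {b p p' : X} (hb : b ∈ V)
    (hp : p ∈ V) (hp' : p' ∈ V) (γ : Path p p') (h : ∀ t, γ t ∈ V) :
    (radial hV hb hp).trans (Homotopic.Quotient.mk γ) = radial hV hb hp' := by
  rw [radial, ← Homotopic.Quotient.mk_trans]
  refine mk_eq_radial hV hb hp' _ fun t => ?_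
  have ht : ((hV.isPathConnected.joinedIn b hb p hp).somePath.trans γ) t ∈
      Set.range ((hV.isPathConnected.joinedIn b hb p hp).somePath.trans γ) := ⟨t, rfl⟩
  rw [Path.trans_range] at ht
  rcases ht with ⟨s, hs⟩ | ⟨s, hs⟩
  · exact hs ▸ JoinedIn.somePath_mem _ s
  · exact hs ▸ h s

/-- A criterion for a subgroup to be the whole fundamental group.  The classes `s i p` join the
base point to the points of `U i`, compatibly with the paths inside `U i`; if they agree on
overlaps up to elements of `H`, then every loop lies in `H`. -/
theorem fundamentalGroup_eq_top_of_cover (hU : ∀ i, IsOpen (U i)) (hcov : ∀ x, ∃ i, x ∈ U i)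
    {q : X} (s : ∀ i p, p ∈ U i → Homotopic.Quotient q p)
    (compat : ∀ i p p' (hp : p ∈ U i) (hp' : p' ∈ U i) (γ : Path p p'), (∀ t, γ t ∈ U i) →
      (s i p hp).trans (Homotopic.Quotient.mk γ) = s i p' hp')
    (H : Subgroup (FundamentalGroup X q))
    (diff : ∀ i j p (hi : p ∈ U i) (hj : p ∈ U j),
      FundamentalGroup.fromPath ((s i p hi).trans (s j p hj).symm) ∈ H)
    (base : ∃ i, ∃ hq : q ∈ U i, s i q hq = Homotopic.Quotient.refl q) : H = ⊤ := by
  rw [eq_top_iff]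
  rintro g -
  have mulmem : ∀ a b : Homotopic.Quotient q q, FundamentalGroup.fromPath a ∈ H →
      FundamentalGroup.fromPath b ∈ H → FundamentalGroup.fromPath (a.trans b) ∈ H :=
    fun a b ha hb => H.mul_mem hb ha
  have key : ∀ {x y : X} (a : Homotopic.Quotient x y), ∀ i j (hi : x ∈ U i) (hj : y ∈ U j),
      FundamentalGroup.fromPath (((s i x hi).trans a).trans (s j y hj).symm) ∈ H := by
    intro x y a
    refine path_induction (P := fun {x y} a => ∀ i j (hi : x ∈ U i) (hj : y ∈ U j),
      FundamentalGroup.fromPath (((s i x hi).trans a).trans (s j y hj).symm) ∈ H) hU hcov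
      ?_ ?_ a
    · intro k x y γ hγ i j hi hj
      have hx : x ∈ U k := by simpa using hγ 0
      have hy : y ∈ U k := by simpa using hγ 1
      have := mulmem _ _ (diff i k x hi hx) (diff k j y hy hj)
      rw [← compat k x y hx hy γ hγ] at this
      simpa only [Homotopic.Quotient.trans_assoc, symm_trans_trans] using this
    · intro x y z a b ha hb i j hi hj
      obtain ⟨k, hk⟩ := hcov y
      have := mulmem _ _ (ha i k hi hk) (hb k j hk hj)
      simpa only [Homotopic.Quotient.trans_assoc, symm_trans_trans] using this
  obtain ⟨i, hq, hs⟩ := base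
  have := key (FundamentalGroup.toPath g) i i hq hq
  rw [hs, Homotopic.Quotient.refl_trans] at this
  rw [show (Homotopic.Quotient.refl q).symm = Homotopic.Quotient.refl q from
    symm_eq_of_trans_eq_refl (Homotopic.Quotient.refl_trans _),
    Homotopic.Quotient.trans_refl] at this
  exact this

/-- The bundle with discrete fibre `G` glued from trivial bundles over the sets `U i` by the
left translations by `φ j p * (φ i p)⁻¹`. -/
noncomputable def cocycleBundle {G : Type*} [Group G] [TopologicalSpace G] [DiscreteTopology G]
    (hU : ∀ i, IsOpen (U i)) (hcov : ∀ x, ∃ i, x ∈ U i) (φ : ι → X → G)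
    (hφ : ∀ i j, ∀ p ∈ U i ∩ U j, ∀ᶠ p' in 𝓝 p, φ j p' * (φ i p')⁻¹ = φ j p * (φ i p)⁻¹) :
    FiberBundleCore ι X G where
  baseSet := U
  isOpen_baseSet := hU
  indexAt x := (hcov x).choose
  mem_baseSet_at x := (hcov x).choose_spec
  coordChange i j p v := φ j p * (φ i p)⁻¹ * v
  coordChange_self i p _ v := by simp
  continuousOn_coordChange i j := by
    rintro ⟨p, v⟩ ⟨hp, -⟩
    refine ContinuousAt.continuousWithinAt ?_
    have h1 : ∀ᶠ z : X × G in 𝓝 (p, v), φ j z.1 * (φ i z.1)⁻¹ = φ j p * (φ i p)⁻¹ :=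
      (continuous_fst.tendsto (p, v) : Filter.Tendsto Prod.fst _ (𝓝 p)).eventually (hφ i j p hp)
    have h2 : ContinuousAt (fun z : X × G => φ j p * (φ i p)⁻¹ * z.2) (p, v) :=
      (continuous_of_discreteTopology.comp continuous_snd).continuousAt
    refine h2.congr ?_
    filter_upwards [h1] with z hz
    rw [hz]
  coordChange_comp i j k p _ v := by group

/-- The holonomy of the bundle glued from the `φ i`, written in the (discontinuous) global
trivialization in which the sections over `U i` are `p ↦ (φ i p)⁻¹ * v`. -/
theorem exists_holonomy {G : Type*} [Group G]
    (hU : ∀ i, IsOpen (U i)) (hcov : ∀ x, ∃ i, x ∈ U i) (φ : ι → X → G)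
    (hφ : ∀ i j, ∀ p ∈ U i ∩ U j, ∀ᶠ p' in 𝓝 p, φ j p' * (φ i p')⁻¹ = φ j p * (φ i p)⁻¹) :
    ∃ N : ∀ {x y : X}, Homotopic.Quotient x y → G,
      (∀ {x y z : X} (a : Homotopic.Quotient x y) (b : Homotopic.Quotient y z),
        N (a.trans b) = N b * N a) ∧
      ∀ i {x y : X} (γ : Path x y), (∀ t, γ t ∈ U i) →
        N (Homotopic.Quotient.mk γ) = (φ i y)⁻¹ * φ i x := by
  let _ : TopologicalSpace G := ⊥
  have : DiscreteTopology G := ⟨rfl⟩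
  let Z := cocycleBundle hU hcov φ hφ
  have cov : IsCoveringMap Z.proj :=
    IsFiberBundle.isCoveringMap fun x => ⟨Z.localTriv (Z.indexAt x), Z.mem_baseSet_at x⟩
  -- the point over `x` with global coordinate `v`, and the coordinate of a point over `x`
  let pt : ∀ x, G → Z.proj ⁻¹' {x} := fun x v => ⟨⟨x, (φ (Z.indexAt x) x * v : G)⟩, rfl⟩
  let co : ∀ x, Z.proj ⁻¹' {x} → G := fun x e => (φ (Z.indexAt x) x)⁻¹ * (show G from e.1.2)
  have hpt : ∀ x e, pt x (co x e) = e := by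
    rintro x ⟨⟨x', e⟩, rfl⟩
    refine Subtype.ext ?_
    change (⟨x', _⟩ : Z.TotalSpace) = ⟨x', e⟩
    congr 1
    exact mul_inv_cancel_left (φ (Z.indexAt x') x') (show G from e)
  have hco : ∀ x v, co x (pt x v) = v := by
    intro x v
    exact inv_mul_cancel_left (φ (Z.indexAt x) x) v
  let M : ∀ {x y : X}, Homotopic.Quotient x y → G → G := fun {x y} a v =>
    co y (cov.monodromy a (pt x v))
  have Mtrans : ∀ {x y z : X} (a : Homotopic.Quotient x y)
      (b : Homotopic.Quotient y z) v, M (a.trans b) v = M b (M a v) := by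
    intro x y z a b v
    simp only [M, cov.monodromy_trans_apply, hpt]
  have Msmall : ∀ i {x y : X} (γ : Path x y), (∀ t, γ t ∈ U i) → ∀ v,
      M (Homotopic.Quotient.mk γ) v = (φ i y)⁻¹ * φ i x * v := by
    intro i x y γ hγ v
    -- the lift of `γ` that is constant in the `i`-th trivialization
    let sec : I → Z.TotalSpace := fun t =>
      (Z.localTriv i).toOpenPartialHomeomorph.symm (γ t, φ i x * v)
    have hsec : Continuous sec := by
      refine (Z.localTriv i).toOpenPartialHomeomorph.continuousOn_symm.comp_continuous
        (f := fun t => (γ t, φ i x * v)) (by fun_prop) fun t => ?_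
      exact ⟨hγ t, trivial⟩
    have hx : x ∈ U i := by simpa using hγ 0
    have hy : y ∈ U i := by simpa using hγ 1
    have hval : ∀ t, sec t = (pt (γ t) ((φ i (γ t))⁻¹ * φ i x * v)).1 := by
      intro t
      change (⟨γ t, _⟩ : Z.TotalSpace) = ⟨γ t, _⟩
      congr 1
      change φ _ _ * (φ i (γ t))⁻¹ * (φ i x * v) = φ _ _ * ((φ i (γ t))⁻¹ * φ i x * v)
      simp only [mul_assoc]
    have h0 : x = Z.proj (pt x v).1 := rfl
    have hlift : (⟨sec, hsec⟩ : C(I, Z.TotalSpace)) =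
        cov.liftPath γ (pt x v).1 (γ.source.trans h0) := by
      rw [cov.eq_liftPath_iff']
      constructor
      · ext t
        exact congrArg Z.proj (hval t)
      · change sec 0 = _
        rw [hval]
        have : ∀ x', x' = x → (pt x' ((φ i x')⁻¹ * φ i x * v)).1 = (pt x v).1 := by
          rintro _ rfl
          rw [inv_mul_cancel, one_mul]
        exact this _ γ.source
    have hmon : (cov.monodromy (Homotopic.Quotient.mk γ) (pt x v)).1 = sec 1 := by
      change cov.liftPath γ (pt x v).1 (γ.source.trans h0) 1 = _
      rw [← hlift]
      rfl
    have : cov.monodromy (Homotopic.Quotient.mk γ) (pt x v) = pt y ((φ i y)⁻¹ * φ i x * v) := by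
      apply Subtype.ext
      rw [hmon, hval]
      have : ∀ y', y' = y → (pt y' ((φ i y')⁻¹ * φ i x * v)).1 =
          (pt y ((φ i y)⁻¹ * φ i x * v)).1 := by
        rintro _ rfl
        rfl
      exact this _ γ.target
    simp only [M, this, hco]
  clear_value M
  -- monodromy commutes with right translations, so it is a left translation
  have Meq : ∀ {x y : X} (a : Homotopic.Quotient x y) v, M a v = M a 1 * v := by
    intro x y a
    refine path_induction (P := fun {x y} a => ∀ v, M a v = M a 1 * v) hU hcov ?_ ?_ a
    · intro i x y γ hγ v
      rw [Msmall i γ hγ, Msmall i γ hγ, mul_one]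
    · intro x y z a b ha hb v
      rw [Mtrans, Mtrans, hb, ha, hb (M a 1), mul_assoc]
  refine ⟨fun a => M a 1, fun a b => ?_, fun i x y γ hγ => ?_⟩
  · change M (a.trans b) 1 = M b 1 * M a 1
    rw [Mtrans, Meq]
  · change M (Homotopic.Quotient.mk γ) 1 = _
    rw [Msmall i γ hγ, mul_one]

end CoverPaths

/-! ### Simply connected sets -/

section Contractible

variable {E : Type*} [NormedAddCommGroup E] [NormedSpace ℝ E]

/-- A set that can be pushed along a fixed vector into a convex part of itself is simply
connected. -/
theorem isSimplyConnected_of_translate {S Q : Set E} (v : E)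
    (hv : ∀ p ∈ S, ∀ t ∈ I, p + t • v ∈ S) (hQ : ∀ p ∈ S, p + v ∈ Q) (hQS : Q ⊆ S)
    (hconv : Convex ℝ Q) {q : E} (hq : q ∈ Q) : IsSimplyConnected S := by
  let g : C(S, S) := ⟨fun p => ⟨p + v, hQS (hQ p p.2)⟩, by fun_prop⟩
  have h1 : (ContinuousMap.id S).Homotopic g := ⟨{
    toFun := fun x => ⟨x.2 + (x.1 : ℝ) • v, hv _ x.2.2 _ x.1.2⟩
    continuous_toFun := by fun_prop
    map_zero_left := by intro x; simp
    map_one_left := by intro x; simp [g] }⟩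
  have h2 : g.Homotopic (ContinuousMap.const S ⟨q, hQS hq⟩) := ⟨{
    toFun := fun x => ⟨(1 - (x.1 : ℝ)) • (x.2 + v) + (x.1 : ℝ) • q,
      hQS (hconv (hQ _ x.2.2) hq (sub_nonneg.2 x.1.2.2) x.1.2.1 (by ring))⟩
    continuous_toFun := by fun_prop
    map_zero_left := by intro x; simp [g]
    map_one_left := by intro x; simp }⟩
  have : ContractibleSpace S :=
    (contractible_iff_id_nullhomotopic S).2 ⟨⟨q, hQS hq⟩, h1.trans h2⟩
  exact SimplyConnectedSpace.ofContractible S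

theorem joinedIn_of_translate {S Q : Set E} (v : E)
    (hv : ∀ p ∈ S, ∀ t ∈ I, p + t • v ∈ S) (hQ : ∀ p ∈ S, p + v ∈ Q) (hQS : Q ⊆ S)
    (hconv : Convex ℝ Q) {p q : E} (hp : p ∈ S) (hq : q ∈ S) : JoinedIn S p q :=
  have up : ∀ p ∈ S, JoinedIn S p (p + v) := fun p hp =>
    JoinedIn.ofLine (f := fun t : ℝ => p + t • v) (by fun_prop) (by simp) (by simp)
      (by rintro _ ⟨t, ht, rfl⟩; exact hv p hp t ht)
  (up p hp).trans (((hconv.isPathConnected ⟨_, hQ p hp⟩).joinedIn _ (hQ p hp) _ (hQ q hq)).mono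
    hQS |>.trans (up q hq).symm)

theorem isSimplyConnected_of_convex {S : Set E} (h : Convex ℝ S) (hne : S.Nonempty) :
    IsSimplyConnected S :=
  isSimplyConnected_of_translate (Q := S) 0 (fun p hp t _ => by simpa using hp) (by simp)
    subset_rfl h hne.some_mem

open Classical in
/-- The radial expansion `p ↦ (1 - t)⁻¹ • p` of `E ∪ {∞}`, which sends everything to `∞` at
`t = 1`. -/
noncomputable def expand (x : I × OnePoint E) : OnePoint E :=
  x.2.elim OnePoint.infty fun p =>
    if x.1 = 1 then OnePoint.infty else ((1 - (x.1 : ℝ))⁻¹ • p : E)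

theorem expand_infty (t : I) : expand (t, (OnePoint.infty : OnePoint E)) = OnePoint.infty := rfl

theorem expand_one (x : OnePoint E) : expand (1, x) = OnePoint.infty := by
  induction x using OnePoint.rec <;> simp [expand]

theorem expand_coe {t : I} (ht : t ≠ 1) (p : E) :
    expand (t, (p : OnePoint E)) = ((1 - (t : ℝ))⁻¹ • p : E) := by
  simp [expand, ht]

theorem tendsto_nhds_infty_of_norm {E : Type*} [NormedAddCommGroup E] {α : Type*} {l : Filter α}
    {f : α → OnePoint E}
    (h : ∀ R : ℝ, 0 < R → ∀ᶠ a in l, ∀ p : E, f a = p → R < ‖p‖) :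
    Filter.Tendsto f l (𝓝 OnePoint.infty) := by
  refine OnePoint.hasBasis_nhds_infty.tendsto_right_iff.2 fun s hs => ?_
  obtain ⟨R, hR, hsub⟩ := hs.2.isBounded.subset_closedBall_lt 0 0
  filter_upwards [h R hR] with a ha
  rcases eq_or_ne (f a) OnePoint.infty with h0 | h0
  · exact Or.inr h0
  · obtain ⟨p, hp⟩ := OnePoint.ne_infty_iff_exists.1 h0
    refine Or.inl ⟨p, fun hps => ?_, hp⟩
    have := hsub hps
    rw [mem_closedBall_zero_iff] at this
    exact absurd (ha p hp.symm) (not_lt.2 this)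

/-- The radial expansion is jointly continuous away from the origin. -/
theorem continuousWithinAt_expand [ProperSpace E] (x : I × OnePoint E)
    {D : Set (OnePoint E)} {ε : ℝ} (hε : 0 < ε) (hD : ∀ p : E, (p : OnePoint E) ∈ D → ε ≤ ‖p‖) :
    ContinuousWithinAt expand (Set.univ ×ˢ D) x := by
  obtain ⟨t, P⟩ := x
  by_cases hP : P = OnePoint.infty
  · subst hP
    refine ContinuousAt.continuousWithinAt ?_
    rw [ContinuousAt, expand_infty]
    refine tendsto_nhds_infty_of_norm fun R hR => ?_
    have hop : IsOpen (((↑) '' Metric.closedBall (0 : E) R : Set (OnePoint E))ᶜ) :=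
      OnePoint.isOpen_compl_image_coe.2 ⟨Metric.isClosed_closedBall, isCompact_closedBall _ _⟩
    filter_upwards [(continuous_snd.tendsto (t, OnePoint.infty)).eventually
      (hop.mem_nhds OnePoint.infty_notMem_image_coe)]
    rintro ⟨s, Q⟩ hQ p hp
    by_cases hs : s = 1
    · rw [hs, expand_one] at hp
      exact absurd hp (OnePoint.infty_ne_coe p)
    induction Q using OnePoint.rec with
    | infty => exact absurd hp (OnePoint.infty_ne_coe p)
    | coe r =>
      rw [expand_coe hs, OnePoint.coe_eq_coe] at hp
      have hr : R < ‖r‖ := by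
        by_contra hcon
        exact hQ ⟨r, mem_closedBall_zero_iff.2 (not_lt.1 hcon), rfl⟩
      have hs1 : (s : ℝ) < 1 := lt_of_le_of_ne s.2.2 fun h => hs (Subtype.ext h)
      rw [← hp, norm_smul, norm_inv, Real.norm_of_nonneg (by linarith)]
      refine hr.trans_le (le_mul_of_one_le_left (norm_nonneg r) ?_)
      exact (one_le_inv₀ (by linarith)).2 (by linarith [s.2.1])
  · obtain ⟨p, rfl⟩ := OnePoint.ne_infty_iff_exists.1 hP
    by_cases ht : t = 1
    · subst ht
      rw [ContinuousWithinAt, expand_one]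
      refine tendsto_nhds_infty_of_norm fun R hR => ?_
      have h1 : ∀ᶠ y : I × OnePoint E in 𝓝[Set.univ ×ˢ D] (1, (p : OnePoint E)),
          (1 - (y.1 : ℝ)) * R < ε := by
        refine Filter.Eventually.filter_mono nhdsWithin_le_nhds ?_
        have : Continuous fun y : I × OnePoint E => (1 - (y.1 : ℝ)) * R := by fun_prop
        exact (this.tendsto _).eventually (gt_mem_nhds (by simpa using hε))
      filter_upwards [h1, self_mem_nhdsWithin]
      rintro ⟨s, Q⟩ hlt ⟨-, hQ⟩ r hr
      by_cases hs : s = 1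
      · rw [hs, expand_one] at hr
        exact absurd hr (OnePoint.infty_ne_coe r)
      induction Q using OnePoint.rec with
      | infty => exact absurd hr (OnePoint.infty_ne_coe r)
      | coe w =>
        rw [expand_coe hs, OnePoint.coe_eq_coe] at hr
        have hs1 : 0 < 1 - (s : ℝ) :=
          sub_pos.2 (lt_of_le_of_ne s.2.2 fun h => hs (Subtype.ext h))
        rw [← hr, norm_smul, norm_inv, Real.norm_of_nonneg hs1.le, ← div_eq_inv_mul,
          lt_div_iff₀ hs1, mul_comm]
        exact lt_of_lt_of_le hlt (hD w hQ)
    · refine ContinuousAt.continuousWithinAt ?_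
      have hemb : IsOpenEmbedding (Prod.map id ((↑) : E → OnePoint E) : I × E → I × OnePoint E) :=
        IsOpenEmbedding.id.prodMap OnePoint.isOpenEmbedding_coe
      refine (hemb.continuousAt_iff (x := (t, p))).1 ?_
      have hc : ContinuousAt (fun y : I × E => (((1 - (y.1 : ℝ))⁻¹ • y.2 : E) : OnePoint E))
          (t, p) := by
        refine OnePoint.continuous_coe.continuousAt.comp ?_
        refine ContinuousAt.smul (ContinuousAt.inv₀ (by fun_prop) ?_) continuousAt_snd
        exact sub_ne_zero.2 fun h => ht (Subtype.ext h.symm)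
      refine hc.congr ?_
      filter_upwards [(continuous_fst.tendsto (t, p)).eventually (isOpen_ne.mem_nhds ht)] with y hy
      exact (expand_coe hy y.2).symm

/-- In `E ∪ {∞}`, the complement of a convex body around the origin is simply connected: it
contracts to `∞` along the rays from the origin. -/
theorem isSimplyConnected_compl_image_coe [ProperSpace E] {B : Set E} (hB : Convex ℝ B)
    (h0 : B ∈ 𝓝 0) : IsSimplyConnected ((↑) '' B : Set (OnePoint E))ᶜ := by
  set D : Set (OnePoint E) := ((↑) '' B)ᶜ with hDdef
  obtain ⟨ε, hε, hball⟩ := Metric.mem_nhds_iff.1 h0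
  have hD : ∀ p : E, (p : OnePoint E) ∈ D → ε ≤ ‖p‖ := fun p hp => by
    by_contra hcon
    exact hp ⟨p, hball (mem_ball_zero_iff.2 (not_le.1 hcon)), rfl⟩
  have hmaps : ∀ t : I, ∀ P ∈ D, expand (t, P) ∈ D := by
    intro t P hP
    by_cases ht : t = 1
    · rw [ht, expand_one]
      exact OnePoint.infty_notMem_image_coe
    induction P using OnePoint.rec with
    | infty => exact OnePoint.infty_notMem_image_coe
    | coe p =>
      rw [expand_coe ht]
      rintro ⟨r, hr, hrp⟩
      rw [OnePoint.coe_eq_coe] at hrp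
      have ht1 : 0 < 1 - (t : ℝ) :=
        sub_pos.2 (lt_of_le_of_ne t.2.2 fun h => ht (Subtype.ext h))
      refine hP ⟨(1 - (t : ℝ)) • r, ?_, ?_⟩
      · have := hB hr (mem_of_mem_nhds h0) ht1.le t.2.1 (by ring)
        simpa using this
      · rw [hrp, smul_smul, mul_inv_cancel₀ ht1.ne', one_smul]
  have hcont : ContinuousOn (expand (E := E)) (Set.univ ×ˢ D) :=
    fun x _ => continuousWithinAt_expand x hε hD
  have : ContractibleSpace D := by
    refine (contractible_iff_id_nullhomotopic D).2
      ⟨⟨OnePoint.infty, OnePoint.infty_notMem_image_coe⟩, ⟨{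
        toFun := fun x => ⟨expand (x.1, x.2.1), hmaps x.1 x.2.1 x.2.2⟩
        continuous_toFun := by
          refine Continuous.subtype_mk ?_ _
          exact hcont.comp_continuous (f := fun x : I × D => (x.1, x.2.1)) (by fun_prop)
            fun x => ⟨trivial, x.2.2⟩
        map_zero_left := ?_
        map_one_left := ?_ }⟩⟩
    · rintro ⟨x, hx⟩
      refine Subtype.ext ?_
      change expand (0, x) = x
      induction x using OnePoint.rec with
      | infty => rfl
      | coe p => rw [expand_coe zero_ne_one]; simp
    · rintro ⟨x, hx⟩
      exact Subtype.ext (expand_one x)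
  exact SimplyConnectedSpace.ofContractible D

end Contractible

/-! ### The diagram of the knot -/

section Diagram

/-- The point `(x, y)` lies under or over a segment of the knot parallel to the `y`-axis.
Since the diagram is symmetric about the diagonal, `OnY y x` says that it lies under or over a
segment parallel to the `x`-axis. -/
def OnY (x y : ℝ) : Prop :=
  (x = 0 ∧ 0 ≤ y ∧ y ≤ 4) ∨ (x = 1 ∧ 2 ≤ y ∧ y ≤ 5) ∨ (x = 2 ∧ 1 ≤ y ∧ y ≤ 3) ∨
  (x = 3 ∧ 2 ≤ y ∧ y ≤ 4) ∨ (x = 4 ∧ 0 ≤ y ∧ y ≤ 3) ∨ (x = 5 ∧ 1 ≤ y ∧ y ≤ 5)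

/-- The corners of the diagram, over which lie the segments parallel to the `z`-axis. -/
def OnZ (x y : ℝ) : Prop :=
  (x = 0 ∧ (y = 0 ∨ y = 4)) ∨ (x = 1 ∧ (y = 2 ∨ y = 5)) ∨ (x = 2 ∧ (y = 1 ∨ y = 3)) ∨
  (x = 3 ∧ (y = 2 ∨ y = 4)) ∨ (x = 4 ∧ (y = 0 ∨ y = 3)) ∨ (x = 5 ∧ (y = 1 ∨ y = 5))

theorem mem_segment_of_line {a b p : E3} (k : Fin 3) (h : ∀ l, l ≠ k → a l = b l) :
    p ∈ segment ℝ a b ↔ (p k ∈ Set.uIcc (a k) (b k)) ∧ ∀ l, l ≠ k → p l = a l := by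
  rw [← segment_eq_uIcc]
  constructor
  · rintro ⟨s, t, hs, ht, hst, rfl⟩
    refine ⟨⟨s, t, hs, ht, hst, by simp⟩, fun l hl => ?_⟩
    simp [← h l hl, ← add_mul, hst]
  · rintro ⟨⟨s, t, hs, ht, hst, hk⟩, hl⟩
    refine ⟨s, t, hs, ht, hst, ?_⟩
    ext l
    by_cases hlk : l = k
    · subst hlk
      simpa using hk
    · rw [hl l hlk]
      simp [← h l hlk, ← add_mul, hst]

theorem coords_of_mem_polygon {p : E3} (h : p ∈ polygon) :
    (OnY (p 0) (p 1) ∧ p 2 = 1) ∨ (OnY (p 1) (p 0) ∧ p 2 = 0) ∨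
      (OnZ (p 0) (p 1) ∧ 0 ≤ p 2 ∧ p 2 ≤ 1) := by
  obtain ⟨i, hi⟩ := Set.mem_iUnion.1 h
  -- the segments are parallel to the `y`-, `z`-, `x`-, `z`-axis, in turn
  have hline : ∀ l, l ≠ (![1, 2, 0, 2, 1, 2, 0, 2, 1, 2, 0, 2, 1, 2, 0, 2, 1, 2, 0, 2, 1, 2, 0, 2]
      i : Fin 3) → vertex i l = vertex (i + 1) l := by
    fin_cases i <;> simp [Fin.forall_fin_succ, vertex]
  rw [mem_segment_of_line _ hline] at hi
  fin_cases i <;> simp [Fin.forall_fin_succ, vertex, Set.mem_uIcc] at hi <;> clear hline <;>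
    grind [OnY, OnZ]

theorem mem_polygon_of_coords {p : E3}
    (h : (OnY (p 0) (p 1) ∧ p 2 = 1) ∨ (OnY (p 1) (p 0) ∧ p 2 = 0) ∨
      (OnZ (p 0) (p 1) ∧ 0 ≤ p 2 ∧ p 2 ≤ 1)) : p ∈ polygon := by
  -- the point lies on the segment from `vertex i`, which is parallel to the `k`-th axis
  have key : ∀ (i : Fin 24) (k : Fin 3), (∀ l, l ≠ k → vertex i l = vertex (i + 1) l) →
      (p k ∈ Set.uIcc (vertex i k) (vertex (i + 1) k) ∧ ∀ l, l ≠ k → p l = vertex i l) →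
      p ∈ polygon := fun i k h h' =>
    Set.mem_iUnion.2 ⟨i, (mem_segment_of_line k h).2 h'⟩
  simp only [OnY, OnZ, or_and_right, and_or_left, or_assoc] at h
  rcases h with h | h | h | h | h | h | h | h | h | h | h | h | h | h | h |
    h | h | h | h | h | h | h | h | h <;>
  [ refine key 0 1 ?_ ?_; refine key 8 1 ?_ ?_; refine key 16 1 ?_ ?_;
    refine key 4 1 ?_ ?_; refine key 20 1 ?_ ?_; refine key 12 1 ?_ ?_;
    refine key 22 0 ?_ ?_; refine key 14 0 ?_ ?_; refine key 6 0 ?_ ?_;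
    refine key 18 0 ?_ ?_; refine key 2 0 ?_ ?_; refine key 10 0 ?_ ?_;
    refine key 23 2 ?_ ?_; refine key 1 2 ?_ ?_; refine key 7 2 ?_ ?_;
    refine key 9 2 ?_ ?_; refine key 15 2 ?_ ?_; refine key 17 2 ?_ ?_;
    refine key 5 2 ?_ ?_; refine key 3 2 ?_ ?_; refine key 21 2 ?_ ?_;
    refine key 19 2 ?_ ?_; refine key 13 2 ?_ ?_; refine key 11 2 ?_ ?_]
  all_goals simp [Fin.forall_fin_succ, vertex, Set.mem_uIcc, h]

end Diagram

/-! ### The faces of the diagram -/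

section Faces

/-- The faces of the diagram: the unbounded face and the five bounded ones, as unions of open
rectangles. -/
def face : Fin 6 → Set (ℝ × ℝ) :=
  ![Set.Iio 0 ×ˢ Set.univ ∪ Set.univ ×ˢ Set.Iio 0 ∪ Set.Ioi 5 ×ˢ Set.univ ∪
      Set.univ ×ˢ Set.Ioi 5 ∪ Set.Ioi 4 ×ˢ Set.Iio 1 ∪ Set.Iio 1 ×ˢ Set.Ioi 4,
    Set.Ioo 0 4 ×ˢ Set.Ioo 0 1 ∪ Set.Ioo 0 2 ×ˢ Set.Ioo 0 2 ∪ Set.Ioo 0 1 ×ˢ Set.Ioo 0 4,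
    Set.Ioo 2 4 ×ˢ Set.Ioo 1 2 ∪ Set.Ioo 3 4 ×ˢ Set.Ioo 1 3,
    Set.Ioo 4 5 ×ˢ Set.Ioo 1 5 ∪ Set.Ioo 3 5 ×ˢ Set.Ioo 3 5 ∪ Set.Ioo 1 5 ×ˢ Set.Ioo 4 5,
    Set.Ioo 1 2 ×ˢ Set.Ioo 2 4 ∪ Set.Ioo 1 3 ×ˢ Set.Ioo 3 4,
    Set.Ioo 2 3 ×ˢ Set.Ioo 2 3]

theorem isOpen_face (r : Fin 6) : IsOpen (face r) := by
  fin_cases r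
  all_goals
    simp only [face]
    repeat' apply IsOpen.union
    all_goals
      refine IsOpen.prod ?_ ?_ <;>
        first | exact isOpen_univ | exact isOpen_Iio | exact isOpen_Ioi | exact isOpen_Ioo

theorem exists_mem_face {x y : ℝ} (h : ¬ OnY x y) (h' : ¬ OnY y x) : ∃ r, (x, y) ∈ face r := by
  simp only [Fin.exists_fin_succ, face, OnY] at *
  simp at *
  grind

theorem face_unique {x y : ℝ} {r s : Fin 6} (h : (x, y) ∈ face r) (h' : (x, y) ∈ face s) :
    r = s := by
  fin_cases r <;> fin_cases s <;> simp [face] at * <;> grind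

theorem not_onY_of_mem_face {x y : ℝ} {r : Fin 6} (h : (x, y) ∈ face r) :
    ¬ OnY x y ∧ ¬ OnY y x := by
  simp only [OnY]
  fin_cases r <;> simp only [face] at h <;> simp at h <;> constructor <;>
    rintro (⟨rfl, h1, h2⟩ | ⟨rfl, h1, h2⟩ | ⟨rfl, h1, h2⟩ | ⟨rfl, h1, h2⟩ | ⟨rfl, h1, h2⟩ |
      ⟨rfl, h1, h2⟩) <;> grind

theorem mem_face_zero {x y : ℝ} (h : ¬ (0 ≤ x ∧ x ≤ 5 ∧ 0 ≤ y ∧ y ≤ 5)) : (x, y) ∈ face 0 := by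
  simp [face]
  grind

/-- A point in each face. -/
noncomputable def facePoint : Fin 6 → ℝ × ℝ :=
  ![(-2, 0), (1 / 2, 1 / 2), (7 / 2, 3 / 2), (9 / 2, 9 / 2), (3 / 2, 7 / 2), (5 / 2, 5 / 2)]

theorem facePoint_mem (r : Fin 6) : facePoint r ∈ face r := by
  fin_cases r <;> simp [face, facePoint] <;> norm_num

theorem joinedIn_of_convex_subset {E : Type*} [AddCommGroup E] [Module ℝ E] [TopologicalSpace E]
    [ContinuousAdd E] [ContinuousSMul ℝ E] {S F : Set E} (hS : Convex ℝ S) (hF : S ⊆ F) {p q : E}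
    (hp : p ∈ S) (hq : q ∈ S) : JoinedIn F p q :=
  ((hS.isPathConnected ⟨p, hp⟩).joinedIn p hp q hq).mono hF

end Faces

/-! ### Connectedness of the faces -/

section FacesConnected

/-- The bounded faces are star-shaped around their marked points; in the unbounded one, every
point is joined to the marked point through at most three of its rectangles. -/
theorem joinedIn_face {p : ℝ × ℝ} {r : Fin 6} (hp : p ∈ face r) :
    JoinedIn (face r) (facePoint r) p := by
  by_cases hr : r = 0
  · subst hr
    obtain ⟨x, y⟩ := p
    have rect : ∀ {A B : Set ℝ} {q q' : ℝ × ℝ}, Convex ℝ A → Convex ℝ B → A ×ˢ B ⊆ face 0 →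
        q ∈ A ×ˢ B → q' ∈ A ×ˢ B → JoinedIn (face 0) q q' :=
      fun hA hB hsub hq hq' => joinedIn_of_convex_subset (hA.prod hB) hsub hq hq'
    have left : ∀ q : ℝ × ℝ, q.1 < 0 → JoinedIn (face 0) (facePoint 0) q := fun q hq =>
      rect (convex_Iio 0) convex_univ (by simp [face]; grind) (by simp [facePoint])
        (by simpa using hq)
    have bottom : ∀ q : ℝ × ℝ, q.2 < 0 → JoinedIn (face 0) (facePoint 0) q := fun q hq =>
      (left (-1, -1) (by norm_num)).trans
        (rect convex_univ (convex_Iio 0) (by simp [face]; grind) (by simp) (by simpa using hq))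
    have top : ∀ q : ℝ × ℝ, 5 < q.2 → JoinedIn (face 0) (facePoint 0) q := fun q hq =>
      (left (-1, 6) (by norm_num)).trans
        (rect convex_univ (convex_Ioi 5) (by simp [face]; grind) (by simp; norm_num)
          (by simpa using hq))
    have right : ∀ q : ℝ × ℝ, 5 < q.1 → JoinedIn (face 0) (facePoint 0) q := fun q hq =>
      (bottom (6, -1) (by norm_num)).trans
        (rect (convex_Ioi 5) convex_univ (by simp [face]; grind) (by simp; norm_num)
          (by simpa using hq))
    simp only [face] at hp
    rcases hp with ((((h | h) | h) | h) | h) | h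
    · exact left _ h.1
    · exact bottom _ h.2
    · exact right _ h.1
    · exact top _ h.2
    · exact (right (6, -1) (by norm_num)).trans
        (rect (convex_Ioi 4) (convex_Iio 1) (by simp [face]; grind) (by simp; norm_num) h)
    · exact (left (-1, 6) (by norm_num)).trans
        (rect (convex_Iio 1) (convex_Ioi 4) (by simp [face]) (by simp; norm_num) h)
  · have hstar : StarConvex ℝ (facePoint r) (face r) := by
      have rect : ∀ {a b a' b' : ℝ} {q : ℝ × ℝ}, q ∈ Set.Ioo a b ×ˢ Set.Ioo a' b' →
          StarConvex ℝ q (Set.Ioo a b ×ˢ Set.Ioo a' b') := fun hq =>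
        ((convex_Ioo _ _).prod (convex_Ioo _ _)).starConvex hq
      fin_cases r
      · exact absurd rfl hr
      all_goals
        simp only [face]
        repeat' apply StarConvex.union
        all_goals
          refine rect ?_
          simp [facePoint]
          norm_num
    exact JoinedIn.ofLine (f := fun t : ℝ => facePoint r + t • (p - facePoint r))
      (by fun_prop) (by simp) (by simp) (by
        rintro _ ⟨t, ht, rfl⟩
        have := hstar hp (sub_nonneg.2 ht.2) ht.1 (by ring)
        convert this using 1
        module)

end FacesConnected

/-! ### The open sets of the cover -/

section Charts

/-- The points of height greater than `-1` from which a vertical ray going up avoids the knot. -/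
def aboveSet : Set E3 :=
  {p | -1 < p 2 ∧ (p 2 ≤ 1 → ¬ OnY (p 0) (p 1)) ∧ (p 2 ≤ 0 → ¬ OnY (p 1) (p 0))}

/-- The points of height less than `2` from which a vertical ray going down avoids the knot. -/
def belowSet : Set E3 :=
  {p | p 2 < 2 ∧ (1 ≤ p 2 → ¬ OnY (p 0) (p 1)) ∧ (0 ≤ p 2 → ¬ OnY (p 1) (p 0))}

/-- A closed box around the knot. -/
def box : Set E3 :=
  {p | (-1 ≤ p 0 ∧ p 0 ≤ 6) ∧ (-1 ≤ p 1 ∧ p 1 ≤ 6) ∧ -1 ≤ p 2 ∧ p 2 ≤ 2}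

/-- The first coordinates of the crossings of the diagram. -/
def crossX : Fin 4 → ℝ := ![1, 2, 3, 4]

/-- The second coordinates of the crossings of the diagram. -/
def crossY : Fin 4 → ℝ := ![4, 2, 3, 1]

/-- A box between the two strands of the knot at a crossing. -/
def crossSet (c : Fin 4) : Set E3 :=
  {p | (crossX c - 1 / 2 < p 0 ∧ p 0 < crossX c + 1 / 2) ∧
    (crossY c - 1 / 2 < p 1 ∧ p 1 < crossY c + 1 / 2) ∧ 0 < p 2 ∧ p 2 < 1}

theorem isClosed_onY {f g : E3 → ℝ} (hf : Continuous f) (hg : Continuous g) :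
    IsClosed {p | OnY (f p) (g p)} := by
  have key : ∀ a b c : ℝ, IsClosed {p | f p = a ∧ b ≤ g p ∧ g p ≤ c} := fun a b c =>
    (isClosed_eq hf continuous_const).inter
      ((isClosed_le continuous_const hg).inter (isClosed_le hg continuous_const))
  exact (key _ _ _).union ((key _ _ _).union ((key _ _ _).union ((key _ _ _).union
    ((key _ _ _).union (key _ _ _)))))

theorem continuous_coord (k : Fin 3) : Continuous fun p : E3 => p k := by
  fun_prop

theorem isOpen_aboveSet : IsOpen aboveSet := by
  have h0 : IsOpen {p : E3 | -1 < p 2} := isOpen_lt continuous_const (continuous_coord 2)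
  have h : ∀ a : ℝ, IsClosed {p : E3 | p 2 ≤ a} := fun a =>
    isClosed_le (continuous_coord 2) continuous_const
  have hY := isClosed_onY (continuous_coord 0) (continuous_coord 1)
  have hX := isClosed_onY (continuous_coord 1) (continuous_coord 0)
  convert h0.inter (((h 1).inter hY).isOpen_compl.inter ((h 0).inter hX).isOpen_compl) using 1
  ext p
  simp [aboveSet]

theorem isOpen_belowSet : IsOpen belowSet := by
  have h0 : IsOpen {p : E3 | p 2 < 2} := isOpen_lt (continuous_coord 2) continuous_const
  have h : ∀ a : ℝ, IsClosed {p : E3 | a ≤ p 2} := fun a =>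
    isClosed_le continuous_const (continuous_coord 2)
  have hY := isClosed_onY (continuous_coord 0) (continuous_coord 1)
  have hX := isClosed_onY (continuous_coord 1) (continuous_coord 0)
  convert h0.inter (((h 1).inter hY).isOpen_compl.inter ((h 0).inter hX).isOpen_compl) using 1
  ext p
  simp [belowSet]

theorem isOpen_crossSet (c : Fin 4) : IsOpen (crossSet c) := by
  have h : ∀ (k : Fin 3) (a b : ℝ), IsOpen {p : E3 | a < p k ∧ p k < b} := fun k a b =>
    (isOpen_lt continuous_const (continuous_coord k)).inter
      (isOpen_lt (continuous_coord k) continuous_const)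
  exact (h 0 _ _).inter ((h 1 _ _).inter (h 2 _ _))

theorem convex_coord (k : Fin 3) {s : Set ℝ} (hs : Convex ℝ s) : Convex ℝ {p : E3 | p k ∈ s} := by
  intro p hp q hq a b ha hb hab
  exact hs hp hq ha hb hab

theorem convex_crossSet (c : Fin 4) : Convex ℝ (crossSet c) :=
  (convex_coord 0 (convex_Ioo _ _)).inter
    ((convex_coord 1 (convex_Ioo _ _)).inter (convex_coord 2 (convex_Ioo _ _)))

theorem convex_box : Convex ℝ box :=
  (convex_coord 0 (convex_Icc _ _)).inter
    ((convex_coord 1 (convex_Icc _ _)).inter (convex_coord 2 (convex_Icc _ _)))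

theorem isCompact_box : IsCompact box := by
  have h : box = (EuclideanSpace.equiv (Fin 3) ℝ).toHomeomorph ⁻¹'
      Set.Icc ![-1, -1, -1] ![6, 6, 2] := by
    ext p
    simp [box, Pi.le_def, Fin.forall_fin_succ]
    tauto
  rw [h, Homeomorph.isCompact_preimage]
  exact isCompact_Icc

theorem box_mem_nhds : box ∈ 𝓝 (0 : E3) := by
  have h : ∀ (k : Fin 3) (a b : ℝ), a < 0 → 0 < b → {p : E3 | a ≤ p k ∧ p k ≤ b} ∈ 𝓝 (0 : E3) :=
    fun k a b ha hb => by
      have : Continuous fun p : E3 => p k := by fun_prop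
      exact this.continuousAt.preimage_mem_nhds (Icc_mem_nhds (by simpa using ha)
        (by simpa using hb))
  exact Filter.inter_mem (h 0 _ _ (by norm_num) (by norm_num))
    (Filter.inter_mem (h 1 _ _ (by norm_num) (by norm_num)) (h 2 _ _ (by norm_num) (by norm_num)))

/-- The vertical vector of length `4`. -/
noncomputable def up : E3 := !₂[0, 0, 4]

theorem add_smul_up_mem_aboveSet {p : E3} (hp : p ∈ aboveSet) {t : ℝ} (ht : t ∈ I) :
    p + t • up ∈ aboveSet := by
  obtain ⟨h0, h1, h2⟩ := hp
  have := ht.1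
  simp only [aboveSet, up, Set.mem_ofPred_eq]
  simp
  exact ⟨by linarith, fun h => h1 (by linarith), fun h => h2 (by linarith)⟩

theorem sub_smul_up_mem_belowSet {p : E3} (hp : p ∈ belowSet) {t : ℝ} (ht : t ∈ I) :
    p + t • (-up) ∈ belowSet := by
  obtain ⟨h0, h1, h2⟩ := hp
  have := ht.1
  simp only [belowSet, up, Set.mem_ofPred_eq]
  simp
  exact ⟨by linarith, fun h => h1 (by linarith), fun h => h2 (by linarith)⟩

theorem isSimplyConnected_aboveSet : IsSimplyConnected aboveSet := by
  refine isSimplyConnected_of_translate (Q := {p : E3 | p 2 ∈ Set.Ioi 2}) (q := up) up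
    (fun p hp t ht => add_smul_up_mem_aboveSet hp ht) (fun p hp => ?_) (fun p hp => ?_)
    (convex_coord 2 (convex_Ioi _)) ?_
  · have := hp.1
    simp [up]
    linarith
  · have : 2 < p 2 := hp
    exact ⟨by linarith, fun h => by linarith, fun h => by linarith⟩
  · simp [up]
    norm_num

theorem isSimplyConnected_belowSet : IsSimplyConnected belowSet := by
  refine isSimplyConnected_of_translate (Q := {p : E3 | p 2 ∈ Set.Iio (-1)}) (q := -up) (-up)
    (fun p hp t ht => sub_smul_up_mem_belowSet hp ht) (fun p hp => ?_) (fun p hp => ?_)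
    (convex_coord 2 (convex_Iio _)) ?_
  · have := hp.1
    simp [up]
    linarith
  · have : p 2 < -1 := hp
    exact ⟨by linarith, fun h => by linarith, fun h => by linarith⟩
  · simp [up]

theorem aboveSet_diff_box_joinedIn {p q : E3} (hp : p ∈ aboveSet \ box) (hq : q ∈ aboveSet \ box) :
    JoinedIn (aboveSet \ box) p q := by
  refine joinedIn_of_translate (Q := {p : E3 | p 2 ∈ Set.Ioi 2}) up (fun p hp t ht => ?_)
    (fun p hp => ?_) (fun p hp => ?_) (convex_coord 2 (convex_Ioi _)) hp hq
  · refine ⟨add_smul_up_mem_aboveSet hp.1 ht, fun h => hp.2 ?_⟩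
    obtain ⟨h0, h1, h2, h3⟩ := h
    have := ht.1
    have := hp.1.1
    simp [up] at h0 h1 h2 h3
    exact ⟨h0, h1, by linarith, by linarith⟩
  · have := hp.1.1
    simp [up]
    linarith
  · have : 2 < p 2 := hp
    exact ⟨⟨by linarith, fun h => by linarith, fun h => by linarith⟩, fun h => by
      linarith [h.2.2.2]⟩

theorem belowSet_diff_box_joinedIn {p q : E3} (hp : p ∈ belowSet \ box) (hq : q ∈ belowSet \ box) :
    JoinedIn (belowSet \ box) p q := by
  refine joinedIn_of_translate (Q := {p : E3 | p 2 ∈ Set.Iio (-1)}) (-up) (fun p hp t ht => ?_)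
    (fun p hp => ?_) (fun p hp => ?_) (convex_coord 2 (convex_Iio _)) hp hq
  · refine ⟨sub_smul_up_mem_belowSet hp.1 ht, fun h => hp.2 ?_⟩
    obtain ⟨h0, h1, h2, h3⟩ := h
    have := ht.1
    have := hp.1.1
    simp [up] at h0 h1 h2 h3
    exact ⟨h0, h1, by linarith, by linarith⟩
  · have := hp.1.1
    simp [up]
    linarith
  · have : p 2 < -1 := hp
    exact ⟨⟨by linarith, fun h => by linarith, fun h => by linarith⟩, fun h => by
      linarith [h.2.2.1]⟩

theorem onY_iff_of_mem_crossSet {c : Fin 4} {p : E3} (hp : p ∈ crossSet c) :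
    OnY (p 0) (p 1) ↔ p 0 = crossX c := by
  simp only [OnY]
  fin_cases c <;> simp [crossSet, crossX, crossY] at * <;> grind

theorem onX_iff_of_mem_crossSet {c : Fin 4} {p : E3} (hp : p ∈ crossSet c) :
    OnY (p 1) (p 0) ↔ p 1 = crossY c := by
  simp only [OnY]
  fin_cases c <;> simp [crossSet, crossX, crossY] at * <;> grind

theorem exists_mem_crossSet {p : E3} (h : OnY (p 0) (p 1)) (h' : OnY (p 1) (p 0))
    (hc : ¬ OnZ (p 0) (p 1)) (h0 : 0 < p 2) (h1 : p 2 < 1) : ∃ c, p ∈ crossSet c := by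
  obtain ⟨c, hx, hy⟩ : ∃ c, p 0 = crossX c ∧ p 1 = crossY c := by
    simp only [Fin.exists_fin_succ, crossX, crossY]
    simp
    rcases h with h | h | h | h | h | h <;> rcases h' with h' | h' | h' | h' | h' | h' <;>
      grind [OnZ]
  refine ⟨c, ?_, ?_, h0, h1⟩
  · rw [hx]
    constructor <;> linarith
  · rw [hy]
    constructor <;> linarith

theorem crossSet_disjoint {c d : Fin 4} {p : E3} (hc : p ∈ crossSet c) (hd : p ∈ crossSet d) :
    c = d := by
  fin_cases c <;> fin_cases d <;> simp [crossSet, crossX, crossY] at * <;> grind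

theorem crossSet_subset_box (c : Fin 4) : crossSet c ⊆ box := by
  intro p hp
  simp only [box, Set.mem_ofPred_eq]
  fin_cases c <;> simp [crossSet, crossX, crossY] at * <;> grind

/-- The faces to the lower left of the crossings. -/
def faceLL : Fin 4 → Fin 6 := ![1, 1, 5, 1]

/-- The faces to the lower right of the crossings. -/
def faceLR : Fin 4 → Fin 6 := ![4, 2, 2, 0]

/-- The faces to the upper left of the crossings. -/
def faceUL : Fin 4 → Fin 6 := ![0, 4, 4, 2]

/-- The faces to the upper right of the crossings. -/
def faceUR : Fin 4 → Fin 6 := ![3, 5, 3, 3]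

theorem mem_face_of_mem_crossSet {c : Fin 4} {p : E3} (hp : p ∈ crossSet c) :
    (p 0 < crossX c → p 1 < crossY c → (p 0, p 1) ∈ face (faceLL c)) ∧
    (crossX c < p 0 → p 1 < crossY c → (p 0, p 1) ∈ face (faceLR c)) ∧
    (p 0 < crossX c → crossY c < p 1 → (p 0, p 1) ∈ face (faceUL c)) ∧
    (crossX c < p 0 → crossY c < p 1 → (p 0, p 1) ∈ face (faceUR c)) := by
  fin_cases c <;> simp [crossSet, crossX, crossY, faceLL, faceLR, faceUL, faceUR, face] at * <;>
    grind

end Charts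

/-! ### The cover of the knot complement -/

section Cover

/-- The complement of the polygonal knot in `ℝ³ ∪ {∞}`. -/
abbrev knotCompl : Set (OnePoint E3) := ((fun p : E3 => (p : OnePoint E3)) '' polygon)ᶜ

/-- The indices of an open cover of the knot complement. -/
inductive Chart
  | above
  | below
  | infinity
  | crossing (c : Fin 4)

/-- The open sets of the cover: the points that see the sky, the points that see the ground, a
neighbourhood of `∞`, and four boxes between the strands at the crossings. -/
def chartSet : Chart → Set (OnePoint E3)
  | .above => (↑) '' aboveSet
  | .below => (↑) '' belowSet
  | .infinity => ((↑) '' box)ᶜ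
  | .crossing c => (↑) '' crossSet c

theorem onY_of_onZ {x y : ℝ} (h : OnZ x y) : OnY x y ∧ OnY y x := by
  simp only [OnY, OnZ] at *
  rcases h with ⟨rfl, rfl | rfl⟩ | ⟨rfl, rfl | rfl⟩ | ⟨rfl, rfl | rfl⟩ | ⟨rfl, rfl | rfl⟩ |
    ⟨rfl, rfl | rfl⟩ | ⟨rfl, rfl | rfl⟩ <;> norm_num

theorem not_onZ_cross (c : Fin 4) : ¬ OnZ (crossX c) (crossY c) := by
  simp only [OnZ]
  fin_cases c <;> simp [crossX, crossY]

theorem polygon_subset_box : polygon ⊆ box := by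
  intro p hp
  have key : ∀ {x y : ℝ}, OnY x y → (0 ≤ x ∧ x ≤ 5) ∧ 0 ≤ y ∧ y ≤ 5 := fun h => by
    simp only [OnY] at h
    grind
  rcases coords_of_mem_polygon hp with ⟨h, h'⟩ | ⟨h, h'⟩ | ⟨h, h0, h1⟩
  · obtain ⟨⟨h2, h3⟩, h4, h5⟩ := key h
    refine ⟨⟨?_, ?_⟩, ⟨?_, ?_⟩, ?_, ?_⟩ <;> linarith
  · obtain ⟨⟨h2, h3⟩, h4, h5⟩ := key h
    refine ⟨⟨?_, ?_⟩, ⟨?_, ?_⟩, ?_, ?_⟩ <;> linarith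
  · obtain ⟨⟨h2, h3⟩, h4, h5⟩ := key (onY_of_onZ h).1
    refine ⟨⟨?_, ?_⟩, ⟨?_, ?_⟩, ?_, ?_⟩ <;> linarith

theorem disjoint_aboveSet {p : E3} (hp : p ∈ aboveSet) : p ∉ polygon := fun h => by
  obtain ⟨-, h1, h2⟩ := hp
  rcases coords_of_mem_polygon h with h | h | h
  · exact h1 h.2.le h.1
  · exact h2 h.2.le h.1
  · exact h1 h.2.2 (onY_of_onZ h.1).1

theorem disjoint_belowSet {p : E3} (hp : p ∈ belowSet) : p ∉ polygon := fun h => by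
  obtain ⟨-, h1, h2⟩ := hp
  rcases coords_of_mem_polygon h with h | h | h
  · exact h1 h.2.ge h.1
  · exact h2 h.2.ge h.1
  · exact h2 h.2.1 (onY_of_onZ h.1).2

theorem disjoint_crossSet {c : Fin 4} {p : E3} (hp : p ∈ crossSet c) : p ∉ polygon := fun h => by
  have hz : 0 < p 2 ∧ p 2 < 1 := hp.2.2
  rcases coords_of_mem_polygon h with h | h | h
  · linarith
  · linarith
  · have hh := onY_of_onZ h.1
    have hx := (onY_iff_of_mem_crossSet hp).1 hh.1
    have hy := (onX_iff_of_mem_crossSet hp).1 hh.2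
    rw [hx, hy] at h
    exact not_onZ_cross c h.1

theorem chartSet_subset (i : Chart) : chartSet i ⊆ knotCompl := by
  rcases i with _ | _ | _ | c
  · rintro _ ⟨p, hp, rfl⟩ ⟨q, hq, h⟩
    exact disjoint_aboveSet hp (OnePoint.coe_injective h ▸ hq)
  · rintro _ ⟨p, hp, rfl⟩ ⟨q, hq, h⟩
    exact disjoint_belowSet hp (OnePoint.coe_injective h ▸ hq)
  · exact Set.compl_subset_compl.2 (Set.image_mono polygon_subset_box)
  · rintro _ ⟨p, hp, rfl⟩ ⟨q, hq, h⟩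
    exact disjoint_crossSet hp (OnePoint.coe_injective h ▸ hq)

theorem exists_mem_chartSet {x : OnePoint E3} (hx : x ∈ knotCompl) : ∃ i, x ∈ chartSet i := by
  have key : ∀ (z : ℝ) (Y X Z : Prop), ¬(-1 < z ∧ (z ≤ 1 → ¬Y) ∧ (z ≤ 0 → ¬X)) →
      ¬(z < 2 ∧ (1 ≤ z → ¬Y) ∧ (0 ≤ z → ¬X)) →
      ¬(Y ∧ z = 1 ∨ X ∧ z = 0 ∨ Z ∧ 0 ≤ z ∧ z ≤ 1) →
      (Y → X → ¬Z → 0 < z → z < 1 → False) → False := by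
    clear hx
    grind
  induction x using OnePoint.rec with
  | infty => exact ⟨.infinity, OnePoint.infty_notMem_image_coe⟩
  | coe p =>
    have hp : p ∉ polygon := fun h => hx ⟨p, h, rfl⟩
    by_contra! hcon
    have hA : p ∉ aboveSet := fun h => hcon .above ⟨p, h, rfl⟩
    have hB : p ∉ belowSet := fun h => hcon .below ⟨p, h, rfl⟩
    have hC : ∀ c, p ∉ crossSet c := fun c h => hcon (.crossing c) ⟨p, h, rfl⟩
    refine key (p 2) (OnY (p 0) (p 1)) (OnY (p 1) (p 0)) (OnZ (p 0) (p 1)) hA hB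
      (fun h => hp (mem_polygon_of_coords h)) fun h1 h2 h3 h4 h5 => ?_
    obtain ⟨c, hc⟩ := exists_mem_crossSet h1 h2 h3 h4 h5
    exact hC c hc

theorem isOpen_chartSet (i : Chart) : IsOpen (chartSet i) := by
  rcases i with _ | _ | _ | c
  · exact OnePoint.isOpen_image_coe.2 isOpen_aboveSet
  · exact OnePoint.isOpen_image_coe.2 isOpen_belowSet
  · exact OnePoint.isOpen_compl_image_coe.2 ⟨isCompact_box.isClosed, isCompact_box⟩
  · exact OnePoint.isOpen_image_coe.2 (isOpen_crossSet c)

theorem isSimplyConnected_chartSet (i : Chart) : IsSimplyConnected (chartSet i) := by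
  have hemb : IsEmbedding ((↑) : E3 → OnePoint E3) := OnePoint.isOpenEmbedding_coe.isEmbedding
  rcases i with _ | _ | _ | c
  · exact hemb.isSimplyConnected_image.2 isSimplyConnected_aboveSet
  · exact hemb.isSimplyConnected_image.2 isSimplyConnected_belowSet
  · exact isSimplyConnected_compl_image_coe convex_box box_mem_nhds
  · refine hemb.isSimplyConnected_image.2 (isSimplyConnected_of_convex (convex_crossSet c) ?_)
    refine ⟨!₂[crossX c, crossY c, 1 / 2], ?_⟩
    simp [crossSet]
    norm_num

/-- The cover of the knot complement, as sets in this space. -/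
def chart (i : Chart) : Set knotCompl := Subtype.val ⁻¹' chartSet i

theorem isOpen_chart (i : Chart) : IsOpen (chart i) :=
  (isOpen_chartSet i).preimage continuous_subtype_val

theorem exists_mem_chart (x : knotCompl) : ∃ i, x ∈ chart i := exists_mem_chartSet x.2

theorem isSimplyConnected_chart (i : Chart) : IsSimplyConnected (chart i) := by
  rw [← IsEmbedding.subtypeVal.isSimplyConnected_image, chart, Set.image_preimage_eq_of_subset]
  · exact isSimplyConnected_chartSet i
  · rw [Subtype.range_coe]
    exact chartSet_subset i

theorem exists_path_of_joinedIn {S : Set E3} {i j : Chart} (hi : (↑) '' S ⊆ chartSet i)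
    (hj : (↑) '' S ⊆ chartSet j) {x y : knotCompl} {p q : E3} (hx : x.1 = p) (hy : y.1 = q)
    (h : JoinedIn S p q) : ∃ γ : Path x y, ∀ t, γ t ∈ chart i ∧ γ t ∈ chart j := by
  obtain ⟨γ, hγ⟩ := h
  refine ⟨⟨⟨fun t => ⟨γ t, chartSet_subset i (hi ⟨_, hγ t, rfl⟩)⟩, ?_⟩, ?_, ?_⟩, fun t =>
    ⟨hi ⟨_, hγ t, rfl⟩, hj ⟨_, hγ t, rfl⟩⟩⟩
  · exact (OnePoint.continuous_coe.comp γ.continuous).subtype_mk _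
  · exact Subtype.ext (by simp [hx])
  · exact Subtype.ext (by simp [hy])

end Cover

/-! ### Loops from the overlaps of the cover -/

section Sections

/-- The marked point of a face, at height `1 / 2`. -/
noncomputable def facePoint3 (r : Fin 6) : E3 := !₂[(facePoint r).1, (facePoint r).2, 1 / 2]

/-- Over a face, the points of height between `-1` and `2` see both the sky and the ground. -/
theorem mem_above_below_of_face {p : E3} {r : Fin 6} (h : (p 0, p 1) ∈ face r) (h1 : -1 < p 2)
    (h2 : p 2 < 2) : p ∈ aboveSet ∧ p ∈ belowSet := by
  have := not_onY_of_mem_face h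
  exact ⟨⟨h1, fun _ => this.1, fun _ => this.2⟩, ⟨h2, fun _ => this.1, fun _ => this.2⟩⟩

theorem exists_face_of_mem {p : E3} (hA : p ∈ aboveSet) (hB : p ∈ belowSet) :
    ∃ r, (p 0, p 1) ∈ face r := by
  refine exists_mem_face ?_ ?_
  · rcases le_total (p 2) 1 with h | h
    · exact hA.2.1 h
    · exact hB.2.1 h
  · rcases le_total (p 2) 0 with h | h
    · exact hA.2.2 h
    · exact hB.2.2 h

theorem facePoint3_mem (r : Fin 6) : ((facePoint3 r) 0, (facePoint3 r) 1) ∈ face r ∧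
    -1 < facePoint3 r 2 ∧ facePoint3 r 2 < 2 := by
  refine ⟨?_, ?_⟩
  · simpa [facePoint3] using facePoint_mem r
  · simp [facePoint3]
    norm_num

/-- The marked point of a face, as a point of the knot complement. -/
noncomputable def markedPoint (r : Fin 6) : knotCompl :=
  ⟨facePoint3 r, chartSet_subset .above ⟨_, (mem_above_below_of_face (facePoint3_mem r).1
    (facePoint3_mem r).2.1 (facePoint3_mem r).2.2).1, rfl⟩⟩

/-- The base point, in the unbounded face. -/
noncomputable abbrev basePoint : knotCompl := markedPoint 0

theorem markedPoint_mem_above (r : Fin 6) : markedPoint r ∈ chart .above :=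
  ⟨_, (mem_above_below_of_face (facePoint3_mem r).1
    (facePoint3_mem r).2.1 (facePoint3_mem r).2.2).1, rfl⟩

theorem markedPoint_mem_below (r : Fin 6) : markedPoint r ∈ chart .below :=
  ⟨_, (mem_above_below_of_face (facePoint3_mem r).1
    (facePoint3_mem r).2.1 (facePoint3_mem r).2.2).2, rfl⟩

theorem basePoint_mem_infinity : basePoint ∈ chart .infinity := by
  rintro ⟨p, hp, h⟩
  have : p = facePoint3 0 := OnePoint.coe_injective h
  rw [this] at hp
  have := hp.1.1
  simp [facePoint3, facePoint] at this

/-- A point near a crossing; the two truth values tell whether it lies on the right and on the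
upper side of the crossing. -/
noncomputable def crossPoint3 (c : Fin 4) (right upper : Bool) : E3 :=
  !₂[crossX c + bif right then 1 / 4 else -1 / 4, crossY c + bif upper then 1 / 4 else -1 / 4,
    1 / 2]

theorem crossPoint3_mem (c : Fin 4) (a b : Bool) : crossPoint3 c a b ∈ crossSet c := by
  simp only [crossSet, crossPoint3, Set.mem_ofPred_eq]
  cases a <;> cases b <;> simp <;> norm_num <;> constructor <;> linarith

theorem mem_aboveSet_of_crossSet {c : Fin 4} {p : E3} (hp : p ∈ crossSet c) (h : p 0 ≠ crossX c) :
    p ∈ aboveSet := by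
  have hz : 0 < p 2 ∧ p 2 < 1 := hp.2.2
  exact ⟨by linarith, fun _ => fun h' => h ((onY_iff_of_mem_crossSet hp).1 h'),
    fun _ => by linarith⟩

theorem mem_belowSet_of_crossSet {c : Fin 4} {p : E3} (hp : p ∈ crossSet c) (h : p 1 ≠ crossY c) :
    p ∈ belowSet := by
  have hz : 0 < p 2 ∧ p 2 < 1 := hp.2.2
  exact ⟨by linarith, fun _ => by linarith,
    fun _ => fun h' => h ((onX_iff_of_mem_crossSet hp).1 h')⟩

theorem ne_crossX_of_mem {c : Fin 4} {p : E3} (hp : p ∈ crossSet c) (hA : p ∈ aboveSet) :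
    p 0 ≠ crossX c := fun h =>
  hA.2.1 (show p 2 ≤ 1 from hp.2.2.2.le) ((onY_iff_of_mem_crossSet hp).2 h)

theorem ne_crossY_of_mem {c : Fin 4} {p : E3} (hp : p ∈ crossSet c) (hB : p ∈ belowSet) :
    p 1 ≠ crossY c := fun h =>
  hB.2.2 (show 0 ≤ p 2 from hp.2.2.1.le) ((onX_iff_of_mem_crossSet hp).2 h)

/-- The point `crossPoint3`, as a point of the knot complement. -/
noncomputable def crossPoint (c : Fin 4) (a b : Bool) : knotCompl :=
  ⟨crossPoint3 c a b, chartSet_subset (.crossing c) ⟨_, crossPoint3_mem c a b, rfl⟩⟩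

theorem crossPoint_mem (c : Fin 4) (a b : Bool) : crossPoint c a b ∈ chart (.crossing c) :=
  ⟨_, crossPoint3_mem c a b, rfl⟩

theorem crossPoint_mem_above (c : Fin 4) (a b : Bool) : crossPoint c a b ∈ chart .above :=
  ⟨_, mem_aboveSet_of_crossSet (crossPoint3_mem c a b) (by cases a <;> simp [crossPoint3]), rfl⟩

theorem crossPoint_mem_below (c : Fin 4) (a b : Bool) : crossPoint c a b ∈ chart .below :=
  ⟨_, mem_belowSet_of_crossSet (crossPoint3_mem c a b) (by cases b <;> simp [crossPoint3]), rfl⟩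

/-- Classes of paths from the base point to the points of each set of the cover. -/
noncomputable def sect : ∀ (i : Chart) (x : knotCompl), x ∈ chart i →
    Homotopic.Quotient basePoint x
  | .above, _, hx => radial (isSimplyConnected_chart .above) (markedPoint_mem_above 0) hx
  | .below, _, hx => radial (isSimplyConnected_chart .below) (markedPoint_mem_below 0) hx
  | .infinity, _, hx => radial (isSimplyConnected_chart .infinity) basePoint_mem_infinity hx
  | .crossing c, _, hx =>
    (radial (isSimplyConnected_chart .above) (markedPoint_mem_above 0)
      (crossPoint_mem_above c false false)).trans
    (radial (isSimplyConnected_chart (.crossing c)) (crossPoint_mem c false false) hx)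

theorem sect_trans_mk (i : Chart) (x y : knotCompl) (hx : x ∈ chart i) (hy : y ∈ chart i)
    (γ : Path x y) (hγ : ∀ t, γ t ∈ chart i) :
    (sect i x hx).trans (Homotopic.Quotient.mk γ) = sect i y hy := by
  rcases i with _ | _ | _ | c
  · exact radial_trans_mk (isSimplyConnected_chart .above) (markedPoint_mem_above 0) hx hy γ hγ
  · exact radial_trans_mk (isSimplyConnected_chart .below) (markedPoint_mem_below 0) hx hy γ hγ
  · exact radial_trans_mk (isSimplyConnected_chart .infinity) basePoint_mem_infinity hx hy γ hγ
  · exact (Homotopic.Quotient.trans_assoc _ _ _).trans (congrArg _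
      (radial_trans_mk (isSimplyConnected_chart (.crossing c)) (crossPoint_mem c false false)
        hx hy γ hγ))

/-- The loop that goes to `x` inside `chart i` and comes back inside `chart j`. -/
noncomputable def transition (i j : Chart) (x : knotCompl) (hi : x ∈ chart i) (hj : x ∈ chart j) :
    FundamentalGroup knotCompl basePoint :=
  FundamentalGroup.fromPath ((sect i x hi).trans (sect j x hj).symm)

theorem transition_self (i : Chart) (x : knotCompl) (hi : x ∈ chart i) :
    transition i i x hi hi = 1 :=
  Homotopic.Quotient.trans_symm _

/-- The product in the fundamental group composes loops from right to left. -/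
theorem transition_mul (i j k : Chart) (x : knotCompl) (hi : x ∈ chart i) (hj : x ∈ chart j)
    (hk : x ∈ chart k) :
    transition j k x hj hk * transition i j x hi hj = transition i k x hi hk := by
  change ((sect i x hi).trans (sect j x hj).symm).trans ((sect j x hj).trans (sect k x hk).symm) =
    (sect i x hi).trans (sect k x hk).symm
  rw [Homotopic.Quotient.trans_assoc, symm_trans_trans]

theorem transition_inv (i j : Chart) (x : knotCompl) (hi : x ∈ chart i) (hj : x ∈ chart j) :
    (transition i j x hi hj)⁻¹ = transition j i x hj hi :=
  inv_eq_of_mul_eq_one_left (by rw [transition_mul, transition_self])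

/-- The transition loops are constant on the path components of the overlaps. -/
theorem transition_eq {S : Set E3} {i j : Chart} (hSi : (↑) '' S ⊆ chartSet i)
    (hSj : (↑) '' S ⊆ chartSet j) {x y : knotCompl} {p q : E3} (hx : x.1 = p) (hy : y.1 = q)
    (h : JoinedIn S p q) (hi : x ∈ chart i) (hj : x ∈ chart j) (hi' : y ∈ chart i)
    (hj' : y ∈ chart j) : transition i j x hi hj = transition i j y hi' hj' := by
  obtain ⟨γ, hγ⟩ := exists_path_of_joinedIn hSi hSj hx hy h
  change (sect i x hi).trans (sect j x hj).symm = (sect i y hi').trans (sect j y hj').symm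
  rw [← sect_trans_mk i x y hi hi' γ fun t => (hγ t).1,
    ← sect_trans_mk j x y hj hj' γ fun t => (hγ t).2, symm_trans_eq,
    Homotopic.Quotient.trans_assoc, trans_symm_trans]

end Sections

/-! ### Generators and relations of the knot group -/

section Presentation

/-- The loop that goes down through the face `r` and comes back through the unbounded face. -/
noncomputable def faceLoop (r : Fin 6) : FundamentalGroup knotCompl basePoint :=
  transition .above .below (markedPoint r) (markedPoint_mem_above r) (markedPoint_mem_below r)

/-- The part over the face `r` of the overlap of `aboveSet` and `belowSet`. -/
def faceColumn (r : Fin 6) : Set E3 := {p | (p 0, p 1) ∈ face r ∧ -1 < p 2 ∧ p 2 < 2}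

theorem isOpen_faceColumn (r : Fin 6) : IsOpen (faceColumn r) :=
  ((isOpen_face r).preimage ((continuous_coord 0).prodMk (continuous_coord 1))).inter
    ((isOpen_lt continuous_const (continuous_coord 2)).inter
      (isOpen_lt (continuous_coord 2) continuous_const))

theorem faceColumn_joinedIn {r : Fin 6} {p : E3} (hp : p ∈ faceColumn r) :
    JoinedIn (faceColumn r) (facePoint3 r) p := by
  obtain ⟨γ, hγ⟩ := joinedIn_face hp.1
  obtain ⟨-, h1, h2⟩ := hp
  have hcont : Continuous fun t : I =>
      (!₂[(γ t).1, (γ t).2, (1 - (t : ℝ)) * (1 / 2) + t * p 2] : E3) := by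
    refine (PiLp.continuous_toLp 2 _).comp (continuous_pi fun k => ?_)
    fin_cases k <;> simp <;> fun_prop
  refine ⟨⟨⟨_, hcont⟩, ?_, ?_⟩, fun t => ⟨?_, ?_⟩⟩
  · simp [facePoint3]
  · ext k
    fin_cases k <;> simp
  · simpa using hγ t
  · have h3 := t.2.1
    have h4 := t.2.2
    change -1 < (1 - (t : ℝ)) * (1 / 2) + t * p 2 ∧ (1 - (t : ℝ)) * (1 / 2) + t * p 2 < 2
    constructor <;> nlinarith

theorem transition_above_below {x : knotCompl} {p : E3} {r : Fin 6} (hx : x.1 = p)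
    (hp : (p 0, p 1) ∈ face r) (hA : x ∈ chart .above) (hB : x ∈ chart .below) :
    transition .above .below x hA hB = faceLoop r := by
  obtain ⟨q, hqA, hq⟩ := id hA
  obtain rfl : q = p := OnePoint.coe_injective (hq.trans hx)
  obtain ⟨q', hqB, hq'⟩ := id hB
  obtain rfl : q' = q := OnePoint.coe_injective (hq'.trans hx)
  have h : ∀ q ∈ faceColumn r, q ∈ aboveSet ∧ q ∈ belowSet := fun q hq =>
    mem_above_below_of_face hq.1 hq.2.1 hq.2.2
  exact (transition_eq (Set.image_mono fun q hq => (h q hq).1)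
    (Set.image_mono fun q hq => (h q hq).2) rfl hx
    (faceColumn_joinedIn ⟨hp, hqA.1, hqB.1⟩) _ _ _ _).symm

theorem sect_above_basePoint : sect .above basePoint (markedPoint_mem_above 0) = .refl _ :=
  radial_self (isSimplyConnected_chart .above) (markedPoint_mem_above 0)

theorem sect_below_basePoint : sect .below basePoint (markedPoint_mem_below 0) = .refl _ :=
  radial_self (isSimplyConnected_chart .below) (markedPoint_mem_below 0)

theorem sect_infinity_basePoint : sect .infinity basePoint basePoint_mem_infinity = .refl _ :=
  radial_self (isSimplyConnected_chart .infinity) basePoint_mem_infinity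

theorem transition_eq_one_of_sect_eq {i j : Chart} {x : knotCompl} {hi : x ∈ chart i}
    {hj : x ∈ chart j} (h : sect i x hi = sect j x hj) : transition i j x hi hj = 1 := by
  rw [transition, h]
  exact Homotopic.Quotient.trans_symm _

/-- The outer face gives the trivial loop. -/
theorem faceLoop_zero : faceLoop 0 = 1 :=
  transition_eq_one_of_sect_eq (sect_above_basePoint.trans sect_below_basePoint.symm)

theorem mem_chart_infinity_iff {x : knotCompl} {p : E3} (hx : x.1 = p) :
    x ∈ chart .infinity ↔ p ∉ box := by
  change x.1 ∉ _ ↔ _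
  rw [hx]
  simp

theorem transition_infinity_above {x : knotCompl} (hi : x ∈ chart .infinity)
    (hA : x ∈ chart .above) : transition .infinity .above x hi hA = 1 := by
  obtain ⟨p, hpA, hp⟩ := id hA
  have hpb := (mem_chart_infinity_iff hp.symm).1 hi
  have hbb := (mem_chart_infinity_iff (x := basePoint) rfl).1 basePoint_mem_infinity
  rw [transition_eq (S := aboveSet \ box) ?_ (Set.image_mono Set.sdiff_subset) hp.symm
    (y := basePoint) rfl (aboveSet_diff_box_joinedIn ⟨hpA, hpb⟩
      ⟨(mem_above_below_of_face (facePoint3_mem 0).1 (facePoint3_mem 0).2.1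
        (facePoint3_mem 0).2.2).1, hbb⟩) hi hA
    basePoint_mem_infinity (markedPoint_mem_above 0)]
  · exact transition_eq_one_of_sect_eq (sect_infinity_basePoint.trans sect_above_basePoint.symm)
  · rintro _ ⟨q, hq, rfl⟩ ⟨q', hq', h⟩
    exact hq.2 (OnePoint.coe_injective h ▸ hq')

theorem transition_infinity_below {x : knotCompl} (hi : x ∈ chart .infinity)
    (hB : x ∈ chart .below) : transition .infinity .below x hi hB = 1 := by
  obtain ⟨p, hpB, hp⟩ := id hB
  have hpb := (mem_chart_infinity_iff hp.symm).1 hi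
  have hbb := (mem_chart_infinity_iff (x := basePoint) rfl).1 basePoint_mem_infinity
  rw [transition_eq (S := belowSet \ box) ?_ (Set.image_mono Set.sdiff_subset) hp.symm
    (y := basePoint) rfl (belowSet_diff_box_joinedIn ⟨hpB, hpb⟩
      ⟨(mem_above_below_of_face (facePoint3_mem 0).1 (facePoint3_mem 0).2.1
        (facePoint3_mem 0).2.2).2, hbb⟩) hi hB
    basePoint_mem_infinity (markedPoint_mem_below 0)]
  · exact transition_eq_one_of_sect_eq (sect_infinity_basePoint.trans sect_below_basePoint.symm)
  · rintro _ ⟨q, hq, rfl⟩ ⟨q', hq', h⟩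
    exact hq.2 (OnePoint.coe_injective h ▸ hq')

/-- The half-lines that make up the complement of a point. -/
def side (b : Bool) (a : ℝ) : Set ℝ := bif b then Set.Ioi a else Set.Iio a

theorem convex_side (b : Bool) (a : ℝ) : Convex ℝ (side b a) := by
  cases b
  · exact convex_Iio a
  · exact convex_Ioi a

theorem ne_of_mem_side {b : Bool} {a x : ℝ} (h : x ∈ side b a) : x ≠ a := by
  cases b
  · exact ne_of_lt h
  · exact ne_of_gt h

theorem exists_mem_side {a x : ℝ} (h : x ≠ a) : ∃ b, x ∈ side b a :=
  h.lt_or_gt.elim (fun h => ⟨false, h⟩) fun h => ⟨true, h⟩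

theorem crossPoint3_mem_side (c : Fin 4) (a b : Bool) :
    crossPoint3 c a b 0 ∈ side a (crossX c) ∧ crossPoint3 c a b 1 ∈ side b (crossY c) := by
  cases a <;> cases b <;> simp [side, crossPoint3] <;> norm_num

/-- The loops at a crossing and the sky only depend on the side of the upper strand. -/
theorem transition_crossing_above {x : knotCompl} {p : E3} {c : Fin 4} {a : Bool} (b : Bool)
    (hx : x.1 = p) (hp : p 0 ∈ side a (crossX c)) (hC : x ∈ chart (.crossing c))
    (hA : x ∈ chart .above) :
    transition (.crossing c) .above x hC hA =
      transition (.crossing c) .above (crossPoint c a b) (crossPoint_mem c a b)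
        (crossPoint_mem_above c a b) := by
  obtain ⟨q, hqC, hq⟩ := id hC
  obtain rfl : q = p := OnePoint.coe_injective (hq.trans hx)
  refine transition_eq (S := crossSet c ∩ {p | p 0 ∈ side a (crossX c)})
    (Set.image_mono Set.inter_subset_left) (Set.image_mono fun q hq =>
      mem_aboveSet_of_crossSet hq.1 (ne_of_mem_side hq.2)) hx rfl ?_ _ _ _ _
  exact joinedIn_of_convex_subset ((convex_crossSet c).inter (convex_coord 0 (convex_side _ _)))
    subset_rfl ⟨hqC, hp⟩ ⟨crossPoint3_mem c a b, (crossPoint3_mem_side c a b).1⟩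

/-- The loops at a crossing and the ground only depend on the side of the lower strand. -/
theorem transition_crossing_below {x : knotCompl} {p : E3} {c : Fin 4} (a : Bool) {b : Bool}
    (hx : x.1 = p) (hp : p 1 ∈ side b (crossY c)) (hC : x ∈ chart (.crossing c))
    (hB : x ∈ chart .below) :
    transition (.crossing c) .below x hC hB =
      transition (.crossing c) .below (crossPoint c a b) (crossPoint_mem c a b)
        (crossPoint_mem_below c a b) := by
  obtain ⟨q, hqC, hq⟩ := id hC
  obtain rfl : q = p := OnePoint.coe_injective (hq.trans hx)
  refine transition_eq (S := crossSet c ∩ {p | p 1 ∈ side b (crossY c)})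
    (Set.image_mono Set.inter_subset_left) (Set.image_mono fun q hq =>
      mem_belowSet_of_crossSet hq.1 (ne_of_mem_side hq.2)) hx rfl ?_ _ _ _ _
  exact joinedIn_of_convex_subset ((convex_crossSet c).inter (convex_coord 1 (convex_side _ _)))
    subset_rfl ⟨hqC, hp⟩ ⟨crossPoint3_mem c a b, (crossPoint3_mem_side c a b).2⟩

/-- On the left of the upper strand the loops at a crossing and the sky are trivial. -/
theorem transition_crossing_above_left (c : Fin 4) (b : Bool) :
    transition (.crossing c) .above (crossPoint c false b) (crossPoint_mem c false b)
      (crossPoint_mem_above c false b) = 1 := by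
  rw [transition_crossing_above false rfl (crossPoint3_mem_side c false b).1]
  refine transition_eq_one_of_sect_eq ?_
  simp only [sect]
  rw [radial_self]
  exact Homotopic.Quotient.trans_refl _

/-- The face in which a point near a crossing lies. -/
def crossFace (c : Fin 4) (a b : Bool) : Fin 6 :=
  bif a then (bif b then faceUR c else faceLR c) else (bif b then faceUL c else faceLL c)

theorem mem_crossFace {c : Fin 4} {p : E3} {a b : Bool} (hp : p ∈ crossSet c)
    (ha : p 0 ∈ side a (crossX c)) (hb : p 1 ∈ side b (crossY c)) :
    (p 0, p 1) ∈ face (crossFace c a b) := by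
  obtain ⟨h1, h2, h3, h4⟩ := mem_face_of_mem_crossSet hp
  cases a <;> cases b
  · exact h1 ha hb
  · exact h3 ha hb
  · exact h2 ha hb
  · exact h4 ha hb

theorem transition_crossPoint (c : Fin 4) (a b : Bool) :
    transition (.crossing c) .below (crossPoint c a b) (crossPoint_mem c a b)
      (crossPoint_mem_below c a b) = faceLoop (crossFace c a b) *
    transition (.crossing c) .above (crossPoint c a b) (crossPoint_mem c a b)
      (crossPoint_mem_above c a b) := by
  rw [← transition_mul _ .above _ _ _ (crossPoint_mem_above c a b),
    transition_above_below (p := crossPoint3 c a b) rfl (mem_crossFace (crossPoint3_mem c a b)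
      (crossPoint3_mem_side c a b).1 (crossPoint3_mem_side c a b).2)]

theorem faceLoop_crossFace (c : Fin 4) (b : Bool) :
    faceLoop (crossFace c false b) = faceLoop (crossFace c true b) *
      transition (.crossing c) .above (crossPoint c true false) (crossPoint_mem c true false)
        (crossPoint_mem_above c true false) := by
  rw [← transition_crossing_above (a := true) (x := crossPoint c true b) false rfl
    (crossPoint3_mem_side c true b).1 (crossPoint_mem c true b) (crossPoint_mem_above c true b),
    ← transition_crossPoint, transition_crossing_below (x := crossPoint c true b) false rfl
      (crossPoint3_mem_side c true b).2 (crossPoint_mem c true b) (crossPoint_mem_below c true b),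
    transition_crossPoint, transition_crossing_above_left, mul_one]

/-- The Dehn relation of a crossing. -/
theorem faceLoop_relation (c : Fin 4) :
    (faceLoop (faceLR c))⁻¹ * faceLoop (faceLL c) =
      (faceLoop (faceUR c))⁻¹ * faceLoop (faceUL c) := by
  have h1 := faceLoop_crossFace c false
  have h2 := faceLoop_crossFace c true
  rw [← inv_mul_eq_iff_eq_mul] at h1 h2
  exact h1.trans h2.symm

theorem mem_chart_crossing_infinity {c : Fin 4} {x : knotCompl} (hC : x ∈ chart (.crossing c))
    (hi : x ∈ chart .infinity) : False := by
  obtain ⟨p, hp, h⟩ := hC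
  exact hi ⟨p, crossSet_subset_box c hp, h⟩

theorem mem_chart_crossing_crossing {c d : Fin 4} {x : knotCompl} (hc : x ∈ chart (.crossing c))
    (hd : x ∈ chart (.crossing d)) : c = d := by
  obtain ⟨p, hp, h⟩ := hc
  obtain ⟨q, hq, h'⟩ := hd
  obtain rfl : q = p := OnePoint.coe_injective (h'.trans h.symm)
  exact crossSet_disjoint hp hq

/-- The Dehn generators generate the knot group. -/
theorem closure_range_faceLoop : Subgroup.closure (Set.range faceLoop) = ⊤ := by
  set H := Subgroup.closure (Set.range faceLoop) with hH
  have hmem : ∀ r, faceLoop r ∈ H := fun r => Subgroup.subset_closure ⟨r, rfl⟩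
  have hAB : ∀ x hA hB, transition .above .below x hA hB ∈ H := fun x hA hB => by
    obtain ⟨p, hpA, hp⟩ := id hA
    obtain ⟨q, hqB, hq⟩ := id hB
    obtain rfl : q = p := OnePoint.coe_injective (hq.trans hp.symm)
    obtain ⟨r, hr⟩ := exists_face_of_mem hpA hqB
    rw [transition_above_below hp.symm hr]
    exact hmem r
  have hcross : ∀ c a, transition (.crossing c) .above (crossPoint c a false)
      (crossPoint_mem c a false) (crossPoint_mem_above c a false) ∈ H := fun c a => by
    cases a
    · rw [transition_crossing_above_left]
      exact H.one_mem
    · rw [← inv_mul_eq_iff_eq_mul.2 (faceLoop_crossFace c false)]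
      exact H.mul_mem (H.inv_mem (hmem _)) (hmem _)
  have hCA : ∀ c x hC hA, transition (.crossing c) .above x hC hA ∈ H := fun c x hC hA => by
    obtain ⟨p, hpA, hp⟩ := id hA
    obtain ⟨q, hqC, hq⟩ := id hC
    obtain rfl : q = p := OnePoint.coe_injective (hq.trans hp.symm)
    obtain ⟨a, ha⟩ := exists_mem_side (ne_crossX_of_mem hqC hpA)
    rw [transition_crossing_above false hp.symm ha]
    exact hcross c a
  have hCB : ∀ c x hC hB, transition (.crossing c) .below x hC hB ∈ H := fun c x hC hB => by
    obtain ⟨p, hpB, hp⟩ := id hB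
    obtain ⟨q, hqC, hq⟩ := id hC
    obtain rfl : q = p := OnePoint.coe_injective (hq.trans hp.symm)
    obtain ⟨b, hb⟩ := exists_mem_side (ne_crossY_of_mem hqC hpB)
    rw [transition_crossing_below false hp.symm hb, transition_crossPoint]
    exact H.mul_mem (hmem _) (hCA c _ _ _)
  have hsymm : ∀ {i j x hi hj}, transition i j x hi hj ∈ H → transition j i x hj hi ∈ H :=
    fun {i j x hi hj} h => by
      rw [← transition_inv]
      exact H.inv_mem h
  refine fundamentalGroup_eq_top_of_cover isOpen_chart exists_mem_chart sect
    sect_trans_mk H (fun i j x hi hj => ?_) ⟨.above, markedPoint_mem_above 0, sect_above_basePoint⟩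
  change transition i j x hi hj ∈ H
  rcases i with _ | _ | _ | c <;> rcases j with _ | _ | _ | d
  · rw [transition_self]; exact H.one_mem
  · exact hAB x hi hj
  · exact hsymm (by rw [transition_infinity_above]; exact H.one_mem)
  · exact hsymm (hCA d x hj hi)
  · exact hsymm (hAB x hj hi)
  · rw [transition_self]; exact H.one_mem
  · exact hsymm (by rw [transition_infinity_below]; exact H.one_mem)
  · exact hsymm (hCB d x hj hi)
  · rw [transition_infinity_above]; exact H.one_mem
  · rw [transition_infinity_below]; exact H.one_mem
  · rw [transition_self]; exact H.one_mem
  · exact (mem_chart_crossing_infinity hj hi).elim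
  · exact hCA c x hi hj
  · exact hCB c x hi hj
  · exact (mem_chart_crossing_infinity hi hj).elim
  · obtain rfl := mem_chart_crossing_crossing hi hj
    rw [transition_self]; exact H.one_mem

end Presentation

/-! ### Representations of the knot group -/

section Representation

variable {Γ : Type*} [Group Γ] (g : Fin 6 → Γ)

open Classical in
/-- The gauge of the chart `below`: the value of `g` at the face over which a point lies, as long
as its height is greater than `-1`. -/
noncomputable def belowGauge (p : E3) : Γ :=
  if h : ∃ r, (p 0, p 1) ∈ face r ∧ -1 < p 2 then g h.choose else 1

theorem belowGauge_of_mem_face {p : E3} {r : Fin 6} (h : (p 0, p 1) ∈ face r) (h' : -1 < p 2) :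
    belowGauge g p = g r := by
  have hex : ∃ r, (p 0, p 1) ∈ face r ∧ -1 < p 2 := ⟨r, h, h'⟩
  rw [belowGauge, dif_pos hex, face_unique hex.choose_spec.1 h]

theorem belowGauge_eq_one {p : E3} (h : ∀ r, (p 0, p 1) ∈ face r → -1 < p 2 → g r = 1) :
    belowGauge g p = 1 := by
  by_cases hex : ∃ r, (p 0, p 1) ∈ face r ∧ -1 < p 2
  · obtain ⟨r, h1, h2⟩ := hex
    rw [belowGauge_of_mem_face g h1 h2, h r h1 h2]
  · rw [belowGauge, dif_neg hex]

open Classical in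
/-- The gauge of the chart at a crossing.  Its values on the wall below the upper strand, where
the gauge of `below` is trivial, are chosen so that the quotient of the two gauges is constant on
both sides of the lower strand. -/
noncomputable def crossGauge (c : Fin 4) (p : E3) : Γ :=
  if p 0 < crossX c then 1 else if crossX c < p 0 then (g (faceLL c))⁻¹ * g (faceLR c)
  else if p 1 < crossY c then (g (faceLL c))⁻¹ else (g (faceUL c))⁻¹

/-- The gauges of all charts, as functions on `ℝ³`. -/
noncomputable def gauge : Chart → E3 → Γ
  | .above, _ => 1
  | .below, p => belowGauge g p
  | .infinity, _ => 1
  | .crossing c, p => crossGauge g c p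

/-- The gauges of all charts, as functions on the knot complement. -/
noncomputable def complGauge (i : Chart) (x : knotCompl) : Γ := 
  OnePoint.elim x.1 1 (gauge g i)

theorem complGauge_of_eq {i : Chart} {x : knotCompl} {p : E3} (hx : x.1 = p) :
    complGauge g i x = gauge g i p := by
  rw [complGauge, hx]
  rfl

/-- The quotient of two gauges is locally constant at a point. -/
def LocallyConst (i j : Chart) (x : knotCompl) : Prop :=
  ∀ᶠ y in 𝓝 x, complGauge g j y * (complGauge g i y)⁻¹ = complGauge g j x * (complGauge g i x)⁻¹

variable {g}

theorem LocallyConst.symm {i j : Chart} {x : knotCompl} (h : LocallyConst g i j x) :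
    LocallyConst g j i x := by
  filter_upwards [h] with y hy
  have := congrArg (·⁻¹) hy
  simpa using this

theorem locallyConst_of_isOpen {i j : Chart} {x : knotCompl} {p : E3} (hx : x.1 = p) {S : Set E3}
    (hS : IsOpen S) (hp : p ∈ S) (k : Γ) (h : ∀ q ∈ S, gauge g j q * (gauge g i q)⁻¹ = k) :
    LocallyConst g i j x := by
  have hnhds : ((↑) '' S : Set (OnePoint E3)) ∈ 𝓝 x.1 :=
    (OnePoint.isOpen_image_coe.2 hS).mem_nhds ⟨p, hp, hx.symm⟩
  filter_upwards [continuous_subtype_val.continuousAt.preimage_mem_nhds hnhds] with y hy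
  obtain ⟨q, hq, hqy⟩ := hy
  rw [complGauge_of_eq g hqy.symm, complGauge_of_eq g hqy.symm, complGauge_of_eq g hx,
    complGauge_of_eq g hx, h q hq, h p hp]

theorem locallyConst_above_below {x : knotCompl} (hA : x ∈ chart .above) (hB : x ∈ chart .below) :
    LocallyConst g .above .below x := by
  obtain ⟨p, hpA, hp⟩ := id hA
  obtain ⟨q, hqB, hq⟩ := id hB
  obtain rfl : q = p := OnePoint.coe_injective (hq.trans hp.symm)
  obtain ⟨r, hr⟩ := exists_face_of_mem hpA hqB
  refine locallyConst_of_isOpen hp.symm (isOpen_faceColumn r) ⟨hr, hpA.1, hqB.1⟩ (g r)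
    fun q hq => ?_
  simp [gauge, belowGauge_of_mem_face g hq.1 hq.2.1]

theorem locallyConst_above_infinity {x : knotCompl} (hA : x ∈ chart .above) :
    LocallyConst g .above .infinity x := by
  obtain ⟨p, hpA, hp⟩ := hA
  exact locallyConst_of_isOpen hp.symm isOpen_univ trivial 1 fun q _ => by simp [gauge]

theorem locallyConst_below_infinity (h0 : g 0 = 1) {x : knotCompl} (hB : x ∈ chart .below)
    (hi : x ∈ chart .infinity) : LocallyConst g .below .infinity x := by
  obtain ⟨p, hpB, hp⟩ := hB
  refine locallyConst_of_isOpen hp.symm (isOpen_belowSet.inter isCompact_box.isClosed.isOpen_compl)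
    ⟨hpB, (mem_chart_infinity_iff hp.symm).1 hi⟩ 1 fun q hq => ?_
  -- outside the box, a point of the layer `-1 < z < 2` lies over the unbounded face
  have : belowGauge g q = 1 := belowGauge_eq_one g fun r hr hz => by
    have hz' := hq.1.1
    rw [face_unique hr (mem_face_zero fun h => hq.2 ⟨⟨by linarith, by linarith⟩,
      ⟨by linarith, by linarith⟩, by linarith, by linarith⟩), h0]
  simp [gauge, this]

theorem isOpen_crossSet_side (c : Fin 4) (k : Fin 3) (b : Bool) (a : ℝ) :
    IsOpen (crossSet c ∩ {p | p k ∈ side b a}) := by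
  refine (isOpen_crossSet c).inter (IsOpen.preimage (continuous_coord k) ?_)
  cases b
  · exact isOpen_Iio
  · exact isOpen_Ioi

theorem locallyConst_above_crossing {x : knotCompl} {c : Fin 4} (hA : x ∈ chart .above)
    (hC : x ∈ chart (.crossing c)) : LocallyConst g .above (.crossing c) x := by
  obtain ⟨p, hpA, hp⟩ := id hA
  obtain ⟨q, hqC, hq⟩ := id hC
  obtain rfl : q = p := OnePoint.coe_injective (hq.trans hp.symm)
  obtain ⟨a, ha⟩ := exists_mem_side (ne_crossX_of_mem hqC hpA)
  refine locallyConst_of_isOpen hp.symm (isOpen_crossSet_side c 0 a (crossX c)) ⟨hqC, ha⟩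
    (bif a then (g (faceLL c))⁻¹ * g (faceLR c) else 1) fun q hq => ?_
  have h := hq.2
  cases a
  · have h : q 0 < crossX c := h
    simp [gauge, crossGauge, h]
  · have h : crossX c < q 0 := h
    simp [gauge, crossGauge, h, h.le]

theorem locallyConst_below_crossing
    (hg : ∀ c, (g (faceLR c))⁻¹ * g (faceLL c) = (g (faceUR c))⁻¹ * g (faceUL c))
    {x : knotCompl} {c : Fin 4} (hB : x ∈ chart .below)
    (hC : x ∈ chart (.crossing c)) : LocallyConst g .below (.crossing c) x := by
  obtain ⟨p, hpB, hp⟩ := id hB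
  obtain ⟨q, hqC, hq⟩ := id hC
  obtain rfl : q = p := OnePoint.coe_injective (hq.trans hp.symm)
  obtain ⟨b, hb⟩ := exists_mem_side (ne_crossY_of_mem hqC hpB)
  refine locallyConst_of_isOpen hp.symm (isOpen_crossSet_side c 1 b (crossY c)) ⟨hqC, hb⟩
    (g (crossFace c false b))⁻¹ fun q ⟨hqc, hqb⟩ => ?_
  have hz : -1 < q 2 := by
    have : 0 < q 2 := hqc.2.2.1
    linarith
  have hrel : (g (faceLL c))⁻¹ * g (faceLR c) = (g (faceUL c))⁻¹ * g (faceUR c) := by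
    have := congrArg (·⁻¹) (hg c)
    simpa using this
  change crossGauge g c q * (belowGauge g q)⁻¹ = _
  rcases lt_trichotomy (q 0) (crossX c) with h | h | h
  · have hf := mem_crossFace (a := false) hqc h hqb
    rw [belowGauge_of_mem_face g hf hz, crossGauge, if_pos h, one_mul]
  · rw [belowGauge_eq_one g fun r hr => absurd ((onY_iff_of_mem_crossSet hqc).2 h)
      (not_onY_of_mem_face hr).1, crossGauge, if_neg h.not_lt, if_neg h.not_gt]
    cases b
    · have h' : q 1 < crossY c := hqb
      rw [if_pos h', inv_one, mul_one]
      rfl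
    · have h' : crossY c < q 1 := hqb
      rw [if_neg h'.not_gt, inv_one, mul_one]
      rfl
  · have hf := mem_crossFace (a := true) hqc h hqb
    rw [belowGauge_of_mem_face g hf hz, crossGauge, if_neg h.not_gt, if_pos h]
    cases b
    · exact mul_inv_cancel_right _ _
    · rw [hrel]
      exact mul_inv_cancel_right _ _

theorem locallyConst_self (i : Chart) (x : knotCompl) : LocallyConst g i i x :=
  Filter.Eventually.of_forall fun y => by simp

theorem locallyConst_of_mem (h0 : g 0 = 1)
    (hg : ∀ c, (g (faceLR c))⁻¹ * g (faceLL c) = (g (faceUR c))⁻¹ * g (faceUL c))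
    (i j : Chart) (x : knotCompl) (hi : x ∈ chart i) (hj : x ∈ chart j) :
    LocallyConst g i j x := by
  rcases i with _ | _ | _ | c <;> rcases j with _ | _ | _ | d
  · exact locallyConst_self _ _
  · exact locallyConst_above_below hi hj
  · exact locallyConst_above_infinity hi
  · exact locallyConst_above_crossing hi hj
  · exact (locallyConst_above_below hj hi).symm
  · exact locallyConst_self _ _
  · exact locallyConst_below_infinity h0 hi hj
  · exact locallyConst_below_crossing hg hi hj
  · exact (locallyConst_above_infinity hj).symm
  · exact (locallyConst_below_infinity h0 hj hi).symm
  · exact locallyConst_self _ _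
  · exact (mem_chart_crossing_infinity hj hi).elim
  · exact (locallyConst_above_crossing hj hi).symm
  · exact (locallyConst_below_crossing hg hj hi).symm
  · exact (mem_chart_crossing_infinity hi hj).elim
  · obtain rfl := mem_chart_crossing_crossing hi hj
    exact locallyConst_self _ _

theorem complGauge_markedPoint_above (r : Fin 6) : complGauge g .above (markedPoint r) = 1 :=
  complGauge_of_eq g (p := facePoint3 r) rfl

theorem complGauge_markedPoint_below (r : Fin 6) : complGauge g .below (markedPoint r) = g r :=
  (complGauge_of_eq g (p := facePoint3 r) rfl).trans
    (belowGauge_of_mem_face g (facePoint3_mem r).1 (facePoint3_mem r).2.1)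

/-- The Dehn relations suffice to define a representation of the knot group: it is the holonomy
of the flat bundle glued from the gauges. -/
theorem exists_hom_of_relations (h0 : g 0 = 1)
    (hg : ∀ c, (g (faceLR c))⁻¹ * g (faceLL c) = (g (faceUR c))⁻¹ * g (faceUL c)) :
    ∃ ρ : FundamentalGroup knotCompl basePoint →* Γ, ∀ r, ρ (faceLoop r) = g r := by
  obtain ⟨N, hmul, hN⟩ := exists_holonomy isOpen_chart exists_mem_chart (complGauge g)
    fun i j p hp => locallyConst_of_mem h0 hg i j p hp.1 hp.2
  have hone : ∀ x, N (Homotopic.Quotient.refl x) = 1 := fun x => by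
    have := hmul (Homotopic.Quotient.refl x) (Homotopic.Quotient.refl x)
    rw [Homotopic.Quotient.trans_refl] at this
    exact left_eq_mul.1 this
  have hsymm : ∀ {x y} (a : Homotopic.Quotient x y), N a.symm = (N a)⁻¹ := fun {x y} a => by
    have := hmul a a.symm
    rw [Homotopic.Quotient.trans_symm, hone] at this
    exact eq_inv_of_mul_eq_one_left this.symm
  have hradial : ∀ i {x y : knotCompl} (hV : IsSimplyConnected (chart i)) (hx : x ∈ chart i)
      (hy : y ∈ chart i), N (radial hV hx hy) = (complGauge g i y)⁻¹ * complGauge g i x :=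
    fun i x y hV hx hy => by
      obtain ⟨γ, hγ⟩ := hV.isPathConnected.joinedIn x hx y hy
      rw [← mk_eq_radial hV hx hy γ hγ]
      exact hN i γ hγ
  refine ⟨MonoidHom.mk' (fun a => N (FundamentalGroup.toPath a)) fun a b => hmul _ _,
    fun r => ?_⟩
  change N ((sect .above _ (markedPoint_mem_above r)).trans
    (sect .below _ (markedPoint_mem_below r)).symm) = g r
  rw [hmul, hsymm, sect, sect, hradial, hradial, complGauge_markedPoint_above,
    complGauge_markedPoint_above, complGauge_markedPoint_below, complGauge_markedPoint_below, h0]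
  simp

end Representation

/-! ### The edge relations -/

section EdgeRelations

variable {Γ : Type*} [Group Γ]

/-- The single relation in two meridians that is left of the Dehn presentation, in two forms that
are cyclic conjugates of each other's inverses. -/
theorem two_generator_relation_iff (a c : Γ) :
    a * c * a⁻¹ * c * a = c * a * c⁻¹ * a * c ↔
      a * (c * a⁻¹ * c⁻¹ * a) = c * a⁻¹ * c⁻¹ * a * c := by
  rw [← mul_inv_eq_one, ← mul_inv_eq_one (a := a * (c * a⁻¹ * c⁻¹ * a))]
  have h : a * (c * a⁻¹ * c⁻¹ * a) * (c * a⁻¹ * c⁻¹ * a * c)⁻¹ =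
      a * c * a⁻¹ * c⁻¹ * a * c⁻¹ * a⁻¹ *
        (a * c * a⁻¹ * c * a * (c * a * c⁻¹ * a * c)⁻¹)⁻¹ *
      (a * c * a⁻¹ * c⁻¹ * a * c⁻¹ * a⁻¹)⁻¹ := by group
  rw [h, conj_eq_one_iff, inv_eq_one]

/-- The generators and the edge relations of the triangulation, from the Dehn presentation. -/
theorem edge_relations_of_dehn {g : Fin 6 → Γ} (h0 : g 0 = 1)
    (hg : ∀ c, (g (faceLR c))⁻¹ * g (faceLL c) = (g (faceUR c))⁻¹ * g (faceUL c)) :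
    g 1 * (g 3 * (g 1)⁻¹ * (g 3)⁻¹ * g 1) = g 3 * (g 1)⁻¹ * (g 3)⁻¹ * g 1 * g 3 ∧
      g 2 = g 3 * g 1 ∧ g 4 = g 1 * g 3 ∧ g 5 = g 3 * g 1 * (g 3)⁻¹ * g 1 * g 3 := by
  have r0 : (g 4)⁻¹ * g 1 = (g 3)⁻¹ * g 0 := hg 0
  have r1 : (g 2)⁻¹ * g 1 = (g 5)⁻¹ * g 4 := hg 1
  have r2 : (g 2)⁻¹ * g 5 = (g 3)⁻¹ * g 4 := hg 2
  have r3 : (g 0)⁻¹ * g 1 = (g 3)⁻¹ * g 2 := hg 3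
  rw [h0, mul_one, inv_mul_eq_iff_eq_mul] at r0
  rw [h0, inv_one, one_mul, eq_inv_mul_iff_mul_eq] at r3
  have h4 : g 4 = g 1 * g 3 := (eq_mul_inv_iff_mul_eq.1 r0).symm
  rw [← r3, h4, inv_mul_eq_iff_eq_mul] at r2
  rw [← r3, h4, r2] at r1
  refine ⟨(two_generator_relation_iff _ _).1 ?_, r3.symm, h4, by rw [r2]; group⟩
  have h := congrArg (fun t => g 3 * g 1 * ((g 3)⁻¹ * (g 1 * g 3)) * t * (g 1)⁻¹ * g 3 * g 1) r1
  group at h ⊢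
  exact h.symm

/-- A solution of the Dehn relations from a solution of the edge relations. -/
theorem dehn_of_edge_relations {a b c : Γ} (h1 : a * b = b * c) (h2 : b * a⁻¹ * c * a = c) :
    b = c * a⁻¹ * c⁻¹ * a ∧ ∃ g : Fin 6 → Γ, g 0 = 1 ∧ g 1 = a ∧ g 3 = c ∧
      ∀ k, (g (faceLR k))⁻¹ * g (faceLL k) = (g (faceUR k))⁻¹ * g (faceUL k) := by
  have hb : b = c * a⁻¹ * c⁻¹ * a := by
    nth_rewrite 1 [← h2]
    group
  rw [hb] at h1
  have hR := (two_generator_relation_iff a c).2 h1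
  refine ⟨hb, ![1, a, c * a, c, a * c, c * a * c⁻¹ * a * c], rfl, rfl, rfl, fun k => ?_⟩
  fin_cases k
  · change (a * c)⁻¹ * a = c⁻¹ * 1
    group
  · change (c * a)⁻¹ * a = (c * a * c⁻¹ * a * c)⁻¹ * (a * c)
    rw [← hR]
    group
  · change (c * a)⁻¹ * (c * a * c⁻¹ * a * c) = c⁻¹ * (a * c)
    group
  · change 1⁻¹ * a = c⁻¹ * (c * a)
    group

end EdgeRelations

/-! ### Eisenstein integers -/

section Eisenstein

theorem omega_re : ω.re = 1 / 2 := by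
  rw [ω, Complex.exp_re]
  simp

theorem omega_im : ω.im = -(√3 / 2) := by
  rw [ω, Complex.exp_im]
  simp

theorem star_omega : star ω = 1 - ω := by
  apply Complex.ext
  · simp [omega_re]
    norm_num
  · simp

theorem conj_omega : (starRingEnd ℂ) ω = 1 - ω := star_omega

theorem omega_sq : ω ^ 2 = ω - 1 := by
  have h3 : √3 * √3 = 3 := Real.mul_self_sqrt (by norm_num)
  apply Complex.ext
  · simp [pow_two, omega_re, omega_im]
    nlinarith
  · simp [pow_two, omega_re, omega_im]
    ring

/-- The Eisenstein integers, as a subalgebra of `ℂ`. -/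
noncomputable abbrev eisenstein : Subalgebra ℤ ℂ := Algebra.adjoin ℤ {ω}

theorem omega_mem : ω ∈ eisenstein := Algebra.subset_adjoin rfl

theorem star_omega_mem : star ω ∈ eisenstein := by
  rw [star_omega]
  exact sub_mem (one_mem _) omega_mem

theorem exists_of_mem_eisenstein {z : ℂ} (hz : z ∈ eisenstein) : ∃ a b : ℤ, z = a + b * ω := by
  induction hz using Algebra.adjoin_induction with
  | mem x hx => exact ⟨0, 1, by rw [Set.mem_singleton_iff.1 hx]; simp⟩
  | algebraMap n => exact ⟨n, 0, by simp⟩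
  | add x y _ _ hx hy =>
    obtain ⟨a, b, rfl⟩ := hx
    obtain ⟨a', b', rfl⟩ := hy
    exact ⟨a + a', b + b', by push_cast; ring⟩
  | mul x y _ _ hx hy =>
    obtain ⟨a, b, rfl⟩ := hx
    obtain ⟨a', b', rfl⟩ := hy
    exact ⟨a * a' - b * b', a * b' + b * a' + b * b', by
      push_cast
      linear_combination (b * b' : ℂ) * omega_sq⟩

/-- The Eisenstein integers are discrete: the norm form takes integral values. -/
theorem eq_zero_of_mem_eisenstein {z : ℂ} (hz : z ∈ eisenstein) (h : ‖z‖ < 1) : z = 0 := by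
  obtain ⟨a, b, rfl⟩ := exists_of_mem_eisenstein hz
  have h3 : √3 * √3 = 3 := Real.mul_self_sqrt (by norm_num)
  have hn : Complex.normSq (a + b * ω) = ((a * a + a * b + b * b : ℤ) : ℝ) := by
    simp [Complex.normSq_apply, omega_re, omega_im]
    linear_combination (b * b / 4 : ℝ) * h3
  have hlt : Complex.normSq (a + b * ω) < 1 := by
    rw [Complex.normSq_eq_norm_sq]
    exact pow_lt_one₀ (norm_nonneg _) h two_ne_zero
  rw [← Complex.normSq_eq_zero, hn]
  rw [hn] at hlt
  have h1 : a * a + a * b + b * b < 1 := by exact_mod_cast hlt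
  have h2 : a * a + a * b + b * b = 0 := by nlinarith [sq_nonneg (a + b), sq_nonneg a, sq_nonneg b]
  rw [h2]
  simp

end Eisenstein

/-! ### The matrices in `U(2,1)` -/

section Matrices

/-- The inverses of the matrices `G i`. -/
noncomputable def Ginv : Fin 3 → Matrix (Fin 3) (Fin 3) ℂ :=
  ![!![1, -ω, -star ω;
       0, 1, star ω;
       0, 0, 1],
    !![1, -ω, -star ω;
       star ω, 0, 1;
       -ω, -1, 1],
    !![1 + star ω, -1 - ω, -star ω;
       0, ω, 1;
       -ω, -star ω, 1]]

/-- The matrices `G i` as elements of `U(2,1)`. -/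
noncomputable def pairing (i : Fin 3) : U21 :=
  ⟨⟨G i, Ginv i, by
    have h := omega_sq
    fin_cases i <;> ext j k <;> fin_cases j <;> fin_cases k <;>
      simp [G, Ginv, Matrix.mul_apply, Fin.sum_univ_three, conj_omega] <;> grind, by
    have h := omega_sq
    fin_cases i <;> ext j k <;> fin_cases j <;> fin_cases k <;>
      simp [G, Ginv, Matrix.mul_apply, Fin.sum_univ_three, conj_omega] <;> grind⟩, by
    have h := omega_sq
    intro z w
    fin_cases i <;> simp [herm, G, Matrix.mulVec, dotProduct, Fin.sum_univ_three, conj_omega] <;> grind⟩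

end Matrices

/-! ### The Picard modular group and discreteness -/

section Lattice

/-- The matrix of an element of `U(2,1)`. -/
def mat (A : U21) : Matrix (Fin 3) (Fin 3) ℂ := ((A : GL (Fin 3) ℂ) : Matrix (Fin 3) (Fin 3) ℂ)

theorem mat_injective : Function.Injective mat := fun _ _ h => Subtype.ext (Units.ext h)

theorem mat_mul (A B : U21) : mat (A * B) = mat A * mat B := rfl

theorem mat_pairing (i : Fin 3) : mat (pairing i) = G i := rfl

theorem mat_pairing_inv (i : Fin 3) : mat (pairing i)⁻¹ = Ginv i := rfl

theorem pairing_relation_one : pairing 0 * pairing 1 = pairing 1 * pairing 2 := by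
  have h := omega_sq
  apply mat_injective
  simp only [mat_mul, mat_pairing]
  ext j k
  fin_cases j <;> fin_cases k <;>
    simp [G, Matrix.mul_apply, Fin.sum_univ_three, conj_omega] <;> grind

theorem pairing_relation_two : pairing 1 * (pairing 0)⁻¹ * pairing 2 * pairing 0 = pairing 2 := by
  have h := omega_sq
  rw [← eq_mul_inv_iff_mul_eq]
  apply mat_injective
  simp only [mat_mul, mat_pairing, mat_pairing_inv]
  ext j k
  fin_cases j <;> fin_cases k <;>
    simp [G, Ginv, Matrix.mul_apply, Fin.sum_univ_three, conj_omega] <;> grind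

theorem pairing_mem (i : Fin 3) : pairing i ∈ SU21Eisenstein := by
  have h := omega_sq
  have h1 : (1 : ℂ) ∈ eisenstein := one_mem _
  have h2 := omega_mem
  have h3 := star_omega_mem
  refine ⟨?_, fun j k => ?_⟩
  · change (G i).det = 1
    rw [Matrix.det_fin_three]
    fin_cases i <;> simp [G, conj_omega] <;> grind
  · change G i j k ∈ eisenstein
    fin_cases i <;> fin_cases j <;> fin_cases k
    all_goals
      simp [G] at h3 ⊢
      try first
        | exact h2
        | exact h3
        | exact sub_mem (neg_mem h1) h3
        | exact add_mem h1 h2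

/-- `SU(2,1,ℤ[ω])` as a subgroup. -/
def specialUnitaryEisenstein : Subgroup U21 where
  carrier := SU21Eisenstein
  one_mem' := by
    refine ⟨Matrix.det_one, fun i j => ?_⟩
    change (1 : Matrix (Fin 3) (Fin 3) ℂ) i j ∈ eisenstein
    rw [Matrix.one_apply]
    split_ifs
    · exact one_mem _
    · exact zero_mem _
  mul_mem' := by
    rintro A B ⟨hA, hA'⟩ ⟨hB, hB'⟩
    refine ⟨?_, fun i j => ?_⟩
    · change (mat A * mat B).det = 1
      rw [Matrix.det_mul, mat, mat, hA, hB, one_mul]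
    · change (mat A * mat B) i j ∈ eisenstein
      rw [Matrix.mul_apply]
      exact sum_mem fun k _ => mul_mem (hA' i k) (hB' k j)
  inv_mem' := by
    rintro A ⟨hA, hA'⟩
    have hmul : mat A⁻¹ * mat A = 1 := by
      rw [← mat_mul, inv_mul_cancel]
      rfl
    -- as the determinant is `1`, the inverse is the adjugate, with polynomial entries
    have hinv : mat A⁻¹ = (mat A).adjugate := by
      have h := Matrix.mul_adjugate (mat A)
      rw [show (mat A).det = 1 from hA, one_smul] at h
      exact left_inv_eq_right_inv hmul h
    let B : Matrix (Fin 3) (Fin 3) eisenstein := fun i j => ⟨mat A i j, hA' i j⟩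
    have hB : B.map (algebraMap eisenstein ℂ) = mat A := rfl
    refine ⟨?_, fun i j => ?_⟩
    · have h := congrArg Matrix.det hmul
      rwa [Matrix.det_mul, Matrix.det_one, mat, mat, hA, mul_one] at h
    · change mat A⁻¹ i j ∈ eisenstein
      rw [hinv, ← hB]
      have := (algebraMap eisenstein ℂ).map_adjugate B
      rw [RingHom.mapMatrix_apply, RingHom.mapMatrix_apply] at this
      rw [← this]
      exact (B.adjugate i j).2

/-- A diagonal element of `U(2,1)` with distinct eigenvalues. -/
noncomputable def boost : U21 :=
  ⟨⟨Matrix.diagonal ![2, 1, 1 / 2], Matrix.diagonal ![1 / 2, 1, 2], by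
    rw [Matrix.diagonal_mul_diagonal, ← Matrix.diagonal_one]
    congr 1
    ext i
    fin_cases i <;> simp, by
    rw [Matrix.diagonal_mul_diagonal, ← Matrix.diagonal_one]
    congr 1
    ext i
    fin_cases i <;> simp⟩, by
    intro z w
    simp [herm, Matrix.mulVec_diagonal]
    ring⟩

/-- The centre of `U(2,1)` consists of unit scalars. -/
theorem exists_scalar_of_mem_center {Z : U21} (hZ : Z ∈ Subgroup.center U21) :
    ∃ l : ℂ, ‖l‖ = 1 ∧ mat Z = Matrix.scalar (Fin 3) l := by
  have hD : mat boost * mat Z = mat Z * mat boost :=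
    congrArg mat (Subgroup.mem_center_iff.1 hZ boost)
  have hG : G 1 * mat Z = mat Z * G 1 :=
    congrArg mat (Subgroup.mem_center_iff.1 hZ (pairing 1))
  -- a matrix commuting with `boost` is diagonal; one commuting with `G 1` as well is a scalar
  have hdiag : ∀ i j, i ≠ j → mat Z i j = 0 := fun i j hij => by
    have h := congrFun (congrFun hD i) j
    rw [show mat boost = Matrix.diagonal ![2, 1, 1 / 2] from rfl, Matrix.diagonal_mul, Matrix.mul_diagonal] at h
    fin_cases i <;> fin_cases j <;> simp at hij h ⊢ <;> grind
  have h01 := congrFun (congrFun hG 0) 1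
  have h12 := congrFun (congrFun hG 1) 2
  have hω : ω ≠ 0 := Complex.exp_ne_zero _
  have hω' : (starRingEnd ℂ) ω ≠ 0 := (map_ne_zero _).2 hω
  simp [Matrix.mul_apply, Fin.sum_univ_three, G, hdiag] at h01 h12
  refine ⟨mat Z 1 1, ?_, ?_⟩
  · have h := Z.2 ![0, 1, 0] ![0, 1, 0]
    change herm (mat Z *ᵥ ![0, 1, 0]) (mat Z *ᵥ ![0, 1, 0]) = _ at h
    simp [herm, Matrix.mulVec, dotProduct, Fin.sum_univ_three, hdiag, Complex.mul_conj,
      Complex.normSq_eq_norm_sq] at h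
    rcases h with h | h
    · exact_mod_cast h
    · have h' : ‖mat Z 1 1‖ = -1 := by exact_mod_cast h
      linarith [norm_nonneg (mat Z 1 1)]
  · ext i j
    by_cases hij : i = j
    · subst hij
      fin_cases i <;> simp [Matrix.scalar_apply] <;> grind
    · rw [hdiag i j hij]
      simp [Matrix.scalar_apply, hij]

theorem mem_center_of_scalar {Z : U21} {l : ℂ} (h : mat Z = Matrix.scalar (Fin 3) l) :
    Z ∈ Subgroup.center U21 := by
  refine Subgroup.mem_center_iff.2 fun A => mat_injective ?_
  rw [mat_mul, mat_mul, h]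
  exact ((Matrix.scalar_commute l (fun r => mul_comm _ _) (mat A)).eq).symm

/-- A neighbourhood of the identity in `U(2,1)`, invariant under the centre. -/
def nearScalar : Set U21 :=
  {A | (∀ i j, i ≠ j → ‖mat A i j‖ < 1) ∧ ∀ i j, ‖mat A i i - mat A j j‖ < 1}

theorem isOpen_nearScalar : IsOpen nearScalar := by
  have hc : ∀ i j, Continuous fun A : U21 => mat A i j := fun i j =>
    (Units.continuous_val.comp continuous_subtype_val).matrix_elem i j
  simp only [nearScalar, Set.ofPred_and, Set.ofPred_forall]
  refine IsOpen.inter ?_ ?_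
  · exact isOpen_iInter_of_finite fun i => isOpen_iInter_of_finite fun j =>
      isOpen_iInter_of_finite fun _ => isOpen_lt (hc i j).norm continuous_const
  · exact isOpen_iInter_of_finite fun i => isOpen_iInter_of_finite fun j =>
      isOpen_lt ((hc i i).sub (hc j j)).norm continuous_const

theorem one_mem_nearScalar : (1 : U21) ∈ nearScalar := by
  have h : mat 1 = 1 := rfl
  constructor
  · intro i j hij
    simp [h, hij]
  · intro i j
    simp [h]

/-- The image of `SU(2,1,ℤ[ω])` in `PU(2,1)` meets a neighbourhood of `1` only in `1`. -/
theorem eq_one_of_mem_nearScalar {B w : U21} (hB : B ∈ SU21Eisenstein) (hw : w ∈ nearScalar)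
    (h : toPU B = toPU w) : toPU B = 1 := by
  obtain ⟨l, hl, hZ⟩ := exists_scalar_of_mem_center (QuotientGroup.eq.1 h)
  have hmat : ∀ i j, mat w i j = mat B i j * l := fun i j => by
    have : mat w = mat B * mat (B⁻¹ * w) := by rw [← mat_mul, mul_inv_cancel_left]
    rw [this, hZ, Matrix.scalar_apply, Matrix.mul_diagonal]
  have hoff : ∀ i j, i ≠ j → mat B i j = 0 := fun i j hij => by
    refine eq_zero_of_mem_eisenstein (hB.2 i j) ?_
    have := hw.1 i j hij
    rwa [hmat, norm_mul, hl, mul_one] at this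
  have hon : ∀ i j, mat B i i - mat B j j = 0 := fun i j => by
    refine eq_zero_of_mem_eisenstein (sub_mem (hB.2 i i) (hB.2 j j)) ?_
    have := hw.2 i j
    rwa [hmat, hmat, ← sub_mul, norm_mul, hl, mul_one] at this
  refine (QuotientGroup.eq_one_iff B).2 (mem_center_of_scalar (l := mat B 0 0) ?_)
  ext i j
  by_cases hij : i = j
  · subst hij
    simpa [Matrix.scalar_apply] using sub_eq_zero.1 (hon i 0)
  · rw [hoff i j hij]
    simp [Matrix.scalar_apply, hij]

/-- The subgroups of `PU(2,1,ℤ[ω])` are discrete: the quotient map is open, so `nearScalar`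
provides a neighbourhood isolating the identity. -/
theorem discreteTopology_of_subset {H : Subgroup PU21}
    (hH : (H : Set PU21) ⊆ toPU '' SU21Eisenstein) : DiscreteTopology H := by
  refine discreteTopology_of_isOpen_singleton_one ?_
  have hopen : IsOpen (toPU '' nearScalar) :=
    QuotientGroup.isOpenMap_coe _ isOpen_nearScalar
  convert hopen.preimage (continuous_subtype_val : Continuous ((↑) : H → PU21)) using 1
  ext x
  constructor
  · rintro rfl
    exact ⟨1, one_mem_nearScalar, map_one toPU⟩
  · rintro ⟨w, hw, hwx⟩
    obtain ⟨B, hB, hBx⟩ := hH x.2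
    refine Subtype.ext ?_
    rw [← hBx]
    exact eq_one_of_mem_nearScalar hB hw (hBx.trans hwx.symm)

end Lattice

/-! ### Independence of the knot and of the base point -/

section Transport

/-- The knot group of the polygon, with the generators of the triangulation and the
representation in `U(2,1)`. -/
theorem exists_generators_of_knotCompl :
    ∃ (γ : Fin 3 → FundamentalGroup knotCompl basePoint)
      (ρ : FundamentalGroup knotCompl basePoint →* U21),
      Subgroup.closure (Set.range γ) = ⊤ ∧ γ 0 * γ 1 = γ 1 * γ 2 ∧
        γ 1 * (γ 0)⁻¹ * γ 2 * γ 0 = γ 2 ∧ ∀ i, ρ (γ i) = pairing i := by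
  obtain ⟨hrel, h2, h4, h5⟩ := edge_relations_of_dehn faceLoop_zero faceLoop_relation
  obtain ⟨hb, g, hg0, hg1, hg3, hg⟩ :=
    dehn_of_edge_relations pairing_relation_one pairing_relation_two
  obtain ⟨ρ, hρ⟩ := exists_hom_of_relations hg0 hg
  set a := faceLoop 1
  set c := faceLoop 3
  refine ⟨![a, c * a⁻¹ * c⁻¹ * a, c], ρ, ?_, hrel, ?_, ?_⟩
  · rw [eq_top_iff, ← closure_range_faceLoop, Subgroup.closure_le]
    set H := Subgroup.closure (Set.range ![a, c * a⁻¹ * c⁻¹ * a, c])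
    have ha : a ∈ H := Subgroup.subset_closure ⟨0, rfl⟩
    have hc : c ∈ H := Subgroup.subset_closure ⟨2, rfl⟩
    rintro _ ⟨r, rfl⟩
    fin_cases r
    · change faceLoop 0 ∈ H
      rw [faceLoop_zero]
      exact H.one_mem
    · exact ha
    · change faceLoop 2 ∈ H
      rw [h2]
      exact H.mul_mem hc ha
    · exact hc
    · change faceLoop 4 ∈ H
      rw [h4]
      exact H.mul_mem ha hc
    · change faceLoop 5 ∈ H
      rw [h5]
      exact H.mul_mem (H.mul_mem (H.mul_mem (H.mul_mem hc ha) (H.inv_mem hc)) ha) hc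
  · change c * a⁻¹ * c⁻¹ * a * a⁻¹ * c * a = c
    group
  · have ha : ρ a = pairing 0 := (hρ 1).trans hg1
    have hc : ρ c = pairing 2 := (hρ 3).trans hg3
    intro i
    fin_cases i
    · exact ha
    · change ρ (c * a⁻¹ * c⁻¹ * a) = pairing 1
      rw [map_mul, map_mul, map_mul, map_inv, map_inv, ha, hc, ← hb]
    · exact hc

/-- The isomorphism of fundamental groups induced by a homeomorphism. -/
noncomputable def fundamentalGroupMulEquivOfHomeomorph {X Y : Type*} [TopologicalSpace X]
    [TopologicalSpace Y] (f : X ≃ₜ Y) (x : X) :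
    FundamentalGroup X x ≃* FundamentalGroup Y (f x) :=
  MonoidHom.toMulEquiv (FundamentalGroup.mapOfEq (f : C(X, Y)) rfl)
    (FundamentalGroup.mapOfEq (f.symm : C(Y, X)) (f.symm_apply_apply x))
    (by
      refine MonoidHom.ext fun p => ?_
      rw [MonoidHom.comp_apply, FundamentalGroup.mapOfEq_apply, FundamentalGroup.mapOfEq_apply]
      obtain ⟨γ, rfl⟩ := Path.Homotopic.Quotient.mk_surjective p
      refine congrArg Path.Homotopic.Quotient.mk (Path.ext (funext fun t => ?_))
      exact f.symm_apply_apply (γ t))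
    (by
      refine MonoidHom.ext fun p => ?_
      rw [MonoidHom.comp_apply, FundamentalGroup.mapOfEq_apply, FundamentalGroup.mapOfEq_apply]
      obtain ⟨γ, rfl⟩ := Path.Homotopic.Quotient.mk_surjective p
      refine congrArg Path.Homotopic.Quotient.mk (Path.ext (funext fun t => ?_))
      exact f.apply_symm_apply (γ t))

theorem nonempty_mulEquiv_of_isFigureEightKnot {K : Set S3} (hK : IsFigureEightKnot K)
    (x : (Kᶜ : Set S3)) : Nonempty (FundamentalGroup (Kᶜ : Set S3) x ≃*
      FundamentalGroup knotCompl basePoint) := by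
  obtain ⟨h, rfl⟩ := hK
  have hiff : ∀ y : S3, y ∈ (h '' ((fun p : E3 => (p : OnePoint E3)) '' polygon))ᶜ ↔
      h.symm y ∈ knotCompl := fun y => by
    rw [Set.mem_compl_iff, Set.mem_compl_iff, ← h.preimage_symm]
    rfl
  let f := h.symm.subtype hiff
  obtain ⟨i, hi⟩ := exists_mem_chart (f x)
  obtain ⟨γ, -⟩ := Path.Homotopic.Quotient.mk_surjective (sect i (f x) hi)
  exact ⟨(fundamentalGroupMulEquivOfHomeomorph f x).trans
    (FundamentalGroup.fundamentalGroupMulEquivOfPath γ.symm)⟩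

theorem range_subset_of_generators {π ι : Type*} [Group π] {γ : ι → π}
    (hγ : Subgroup.closure (Set.range γ) = ⊤) {ρ : π →* PU21}
    (h : ∀ i, ρ (γ i) ∈ toPU '' SU21Eisenstein) :
    (ρ.range : Set PU21) ⊆ toPU '' SU21Eisenstein := by
  have hle : ρ.range ≤ specialUnitaryEisenstein.map toPU := by
    rw [MonoidHom.range_eq_map, ← hγ, MonoidHom.map_closure, Subgroup.closure_le]
    rintro _ ⟨_, ⟨i, rfl⟩, rfl⟩
    exact h i
  exact hle

end Transport

end FigureEight

theorem mainTheorem2 (K : Set FigureEight.S3) (hK : FigureEight.IsFigureEightKnot K)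
    (x : (Kᶜ : Set FigureEight.S3)) :
    ∃ (γ : Fin 3 → FundamentalGroup (Kᶜ : Set FigureEight.S3) x)
      (ρ : FundamentalGroup (Kᶜ : Set FigureEight.S3) x →* FigureEight.PU21)
      (A : Fin 3 → FigureEight.U21),
      -- the side pairings generate the knot group and satisfy the two edge relations
      Subgroup.closure (Set.range γ) = ⊤ ∧
      γ 0 * γ 1 = γ 1 * γ 2 ∧
      γ 1 * (γ 0)⁻¹ * γ 2 * γ 0 = γ 2 ∧
      -- they are sent to the classes of the explicit matrices, which lie in `SU(2,1,ℤ[ω])`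
      (∀ i, ((A i : GL (Fin 3) ℂ) : Matrix (Fin 3) (Fin 3) ℂ) = FigureEight.G i) ∧
      (∀ i, A i ∈ FigureEight.SU21Eisenstein) ∧
      (∀ i, ρ (γ i) = FigureEight.toPU (A i)) ∧
      -- the image lies in `PU(2,1,ℤ[ω])` and is a discrete subgroup of `PU(2,1)`
      (ρ.range : Set FigureEight.PU21) ⊆ FigureEight.toPU '' FigureEight.SU21Eisenstein ∧
      DiscreteTopology ρ.range := by
  obtain ⟨e⟩ := FigureEight.nonempty_mulEquiv_of_isFigureEightKnot hK x
  obtain ⟨γ, ρ, htop, h1, h2, hρ⟩ := FigureEight.exists_generators_of_knotCompl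
  have hgen : Subgroup.closure (Set.range fun i => e.symm (γ i)) = ⊤ := by
    have h := congrArg (Subgroup.map e.symm.toMonoidHom) htop
    rw [MonoidHom.map_closure, ← Set.range_comp,
      Subgroup.map_top_of_surjective _ e.symm.surjective] at h
    exact h
  have himage : ∀ i, (FigureEight.toPU.comp (ρ.comp e.toMonoidHom)) (e.symm (γ i)) =
      FigureEight.toPU (FigureEight.pairing i) := fun i => by
    simp [hρ]
  have hrange := FigureEight.range_subset_of_generators hgen fun i =>
    ⟨_, FigureEight.pairing_mem i, (himage i).symm⟩
  refine ⟨fun i => e.symm (γ i), FigureEight.toPU.comp (ρ.comp e.toMonoidHom),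
    FigureEight.pairing, hgen, ?_, ?_, FigureEight.mat_pairing, FigureEight.pairing_mem, himage,
    hrange, FigureEight.discreteTopology_of_subset hrange⟩
  · rw [← map_mul, ← map_mul, h1]
  · rw [← map_inv, ← map_mul, ← map_mul, ← map_mul, h2]
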